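/- Let $M_1$, $M_2$ be smooth manifolds of dimensions $k_1$, $k_2$, with pseudo-Riemannian metrics $\bar g_1$, $\bar g_2$ of index $q_1$, $q_2$ and Poisson tensors $\Pi_1$, $\Pi_2$. Let $f_1,\nu_1\in C^\infty(M_1)$ with $f_1>0$. Write $\pi_i:M_1\times M_2\to M_i$ for the projections and $(\cdot)^h$, $(\cdot)^v$ for the lifts (pull-backs) of functions and one-forms along $\pi_1$, $\pi_2$. Equip $M=M_1\times M_2$ with the warped metric $\bar g^{f_1}=\pi_1^*\bar g_1+(f_1^h)^2\pi_2^*\bar g_2$ and the bivector field $\Pi^{\nu_1}=\Pi_1+\nu_1^h\,\Pi_2$. For a bivector field $\Pi$ and a metric $\bar g$ on a manifold, let $\sharp_\Pi$ be given by $\eta(\sharp_\Pi\omega)=\Pi(\omega,\eta)$, let $\tilde g(\omega,\eta)=\bar g(\sharp_{\bar g}\omega,\sharp_{\bar g}\eta)$ be the cometric, with $\sharp_{\bar g}$ the inverse of $v\mapsto\bar g(v,\cdot)$, and let $J$ be the endomorphism field of the cotangent bundle with $\Pi(\omega,\eta)=\tilde g(J\omega,\eta)$. The contravariant Levi-Civita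 connection $\mathcal D$ of $(\tilde g,\Pi)$ is the contravariant connection on one-forms (function-linear in $\omega$, with $\mathcal D_\omega(f\eta)=f\mathcal D_\omega\eta+\sharp_\Pi(\omega)(f)\,\eta$) that satisfies $$\mathcal D_\omega\eta-\mathcal D_\eta\omega=\mathcal L_{\sharp_\Pi\omega}\eta-\mathcal L_{\sharp_\Pi\eta}\omega-d(\Pi(\omega,\eta)),\qquad \sharp_\Pi(\omega)\,\tilde g(\eta,\gamma)=\tilde g(\mathcal D_\omega\eta,\gamma)+\tilde g(\eta,\mathcal D_\omega\gamma).$$ For functions, $\mathcal D_\omega u=\sharp_\Pi(\omega)(u)$ and $\mathcal D^2_{\omega,\eta}u=\mathcal D_\omega(\mathcal D_\eta u)-\mathcal D_{\mathcal D_\omega\eta}u$. With respect to a local coframe $(e_i)$, the contravariant Laplacian of a function is $\Delta^{\mathcal D}u=-\sum_i\mathcal D^2_{e_i,e_i}u$ (no signs $\tilde g(e_i,e_i)$ enter the sum, so for indefinite metrics it may depend on the coframe). Let $J_1$ be the endomorphism field of $(\bar g_1,\Pi_1)$, and let $\mathcal D^{M_1}$, $\mathcal D^{M_2}$, $\mathcal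 D$ be the contravariant Levi-Civita connections of $(\tilde g_1,\Pi_1)$, $(\tilde g_2,\Pi_2)$ and $(\tilde g^{f_1},\Pi^{\nu_1})$, where $\tilde g_i$ and $\tilde g^{f_1}$ are the cometrics of $\bar g_i$ and $\bar g^{f_1}$. Let $dx_1,\dots,dx_{k_1}$ and $dy_1,\dots,dy_{k_2}$ be smooth orthonormal coframes, on open sets $U_1\subseteq M_1$ and $U_2\subseteq M_2$, for $\tilde g_1$ and $\tilde g_2$ (the first $q_1$, respectively $q_2$, one-forms having square $-1$ and the others $+1$; $dx_i$, $dy_j$ need not be closed). Let the Laplacians $\Delta^{\mathcal D^{M_1}}$, $\Delta^{\mathcal D^{M_2}}$, $\Delta^{\mathcal D}$ be taken with respect to $(dx_i)$, $(dy_j)$ and the coframe $(dx_1^h,\dots,dx_{k_1}^h,f_1^h\,dy_1^v,\dots,f_1^h\,dy_{k_2}^v)$ respectively. Then for all $u_1\in C^\infty(M_1)$, $u_2\in C^\infty(M_2)$ and $u=u_1^h+u_2^v$, on $U_1\times U_2$, $$\Delta^{\mathcal D}u=\bigl(\Delta^{\mathcal D^{M_1}}u_1\bigr)^h+\frac{k_2-2q_2}{f_1^h}\,\tilde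 g_1\bigl(J_1df_1,\,J_1du_1\bigr)^h+(\nu_1^hf_1^h)^2\bigl(\Delta^{\mathcal D^{M_2}}u_2\bigr)^v .$$ -/

import Mathlib

open scoped Manifold ContDiff

noncomputable section

namespace ContravariantWarped

section General

variable {E : Type*} [NormedAddCommGroup E] [NormedSpace ℝ E]
  {H : Type*} [TopologicalSpace H] (I : ModelWithCorners ℝ E H)
  (M : Type*) [TopologicalSpace M] [ChartedSpace H M]

/-- Rough (not necessarily smooth) vector fields on `M`. -/
abbrev VectorFieldOn := (x : M) → TangentSpace I x

/-- Rough (not necessarily smooth) one-forms on `M`. Smoothness on an open set is the separate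
predicate `SmoothForm`. -/
abbrev OneForm := (x : M) → (TangentSpace I x →L[ℝ] ℝ)

/-- Rough fields of bilinear forms on the tangent spaces of `M`. -/
abbrev BilinField := (x : M) → (TangentSpace I x →L[ℝ] TangentSpace I x →L[ℝ] ℝ)

/-- Rough bivector fields on `M`, each given by its sharp map `♯ : T*M → TM`; the bivector itself
is `Π(θ, η) = η(♯θ)`, see `pair`. Skew-symmetry and smoothness are in `IsBivector`. -/
abbrev BivectorField := (x : M) → ((TangentSpace I x →L[ℝ] ℝ) →L[ℝ] TangentSpace I x)

variable {M}

/-- The vector field `X` is smooth on the set `U`. -/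
def SmoothField [IsManifold I ∞ M] (U : Set M) (X : VectorFieldOn I M) : Prop :=
  ContMDiffOn I (I.prod 𝓘(ℝ, E)) ∞
    (fun x => (Bundle.TotalSpace.mk' E x (X x) : TangentBundle I M)) U

/-- The one-form `θ` is smooth on the set `U`, as a section of the cotangent bundle. -/
def SmoothForm [IsManifold I ∞ M] (U : Set M) (θ : OneForm I M) : Prop :=
  ContMDiffOn I (I.prod 𝓘(ℝ, E →L[ℝ] ℝ)) ∞
    (fun x => Bundle.TotalSpace.mk' (E →L[ℝ] ℝ)
      (E := fun x : M => TangentSpace I x →L[ℝ] ℝ) x (θ x)) U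

/-- The differential `du` of a real function. -/
def differential (u : M → ℝ) : OneForm I M := fun x => mvfderiv I u x

/-! ### Pseudo-Riemannian metrics and their cometrics -/

/-- `g` is a pseudo-Riemannian metric of index `q`: a smooth field of symmetric nondegenerate
bilinear forms on the tangent spaces, the maximal dimension of a negative definite subspace
being `q` at every point. -/
structure IsPseudoRiemannian [IsManifold I ∞ M] (g : BilinField I M) (q : ℕ) : Prop where
  symm : ∀ x v w, g x v w = g x w v
  nondegenerate : ∀ x v, (∀ w, g x v w = 0) → v = 0
  smooth : ContMDiff I (I.prod 𝓘(ℝ, E →L[ℝ] E →L[ℝ] ℝ)) ∞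
    (fun x => Bundle.TotalSpace.mk' (E →L[ℝ] E →L[ℝ] ℝ)
      (E := fun x : M => TangentSpace I x →L[ℝ] TangentSpace I x →L[ℝ] ℝ) x (g x))
  index : ∀ x, sigNeg
    (LinearMap.BilinMap.toQuadraticMap
      ((ContinuousLinearMap.coeLM ℝ).comp (g x).toLinearMap :
        LinearMap.BilinForm ℝ (TangentSpace I x))) = q

variable {I}

/-- The musical isomorphism `♯_g : T*M → TM` at `x`, the inverse of `♭_g : v ↦ g(v, ·)`. -/
def musicalSharp (g : BilinField I M) (x : M) :
    (TangentSpace I x →L[ℝ] ℝ) →L[ℝ] TangentSpace I x :=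
  ContinuousLinearMap.inverse (g x)

/-- The cometric `g̃(α, β) = g(♯_g α, ♯_g β)` of `g` at `x`. -/
def cometric (g : BilinField I M) (x : M) (α β : TangentSpace I x →L[ℝ] ℝ) : ℝ :=
  g x (musicalSharp g x α) (musicalSharp g x β)

/-- The one-forms `e 0, …, e (k-1)` are a smooth orthonormal coframe on `U` for the cometric of a
metric of index `q`: the first `q` of them have square `-1`, the others `1`. -/
structure IsOrthonormalCoframe [IsManifold I ∞ M] (g : BilinField I M) (q : ℕ) {k : ℕ}
    (U : Set M) (e : Fin k → OneForm I M) : Prop where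
  smooth : ∀ i, SmoothForm I U (e i)
  orthonormal : ∀ x ∈ U, ∀ i j, cometric g x (e i x) (e j x) =
    if i = j then (if (i : ℕ) < q then -1 else 1) else 0

/-! ### Poisson tensors -/

/-- The function `Π(θ, η) = η(♯θ)`. -/
def pair (P : BivectorField I M) (θ η : OneForm I M) : M → ℝ := fun x => η x (P x (θ x))

/-- The vector field `♯θ`. -/
def sharp (P : BivectorField I M) (θ : OneForm I M) : VectorFieldOn I M := fun x => P x (θ x)

variable (I) in
/-- The Poisson bracket `{u, v} = Π(du, dv)`. -/
def poissonBracket (P : BivectorField I M) (u v : M → ℝ) : M → ℝ :=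
  pair P (differential I u) (differential I v)

/-- `P` is a smooth bivector field: it is skew-symmetric and its sharp map sends smooth one-forms
to smooth vector fields. -/
structure IsBivector [IsManifold I ∞ M] (P : BivectorField I M) : Prop where
  skew : ∀ x (α β : TangentSpace I x →L[ℝ] ℝ), β (P x α) = -α (P x β)
  smooth : ∀ U : Set M, IsOpen U → ∀ θ : OneForm I M, SmoothForm I U θ →
    SmoothField I U (sharp P θ)

/-- `P` is a Poisson tensor: a smooth bivector field with vanishing Schouten square, that is, whose
bracket satisfies the Jacobi identity. -/
structure IsPoisson [IsManifold I ∞ M] (P : BivectorField I M) : Prop extends IsBivector P where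
  jacobi : ∀ U : Set M, IsOpen U → ∀ u v w : M → ℝ,
    ContMDiffOn I 𝓘(ℝ, ℝ) ∞ u U → ContMDiffOn I 𝓘(ℝ, ℝ) ∞ v U → ContMDiffOn I 𝓘(ℝ, ℝ) ∞ w U →
    ∀ x ∈ U, poissonBracket I P (poissonBracket I P u v) w x
      + poissonBracket I P (poissonBracket I P v w) u x
      + poissonBracket I P (poissonBracket I P w u) v x = 0

/-- The field of endomorphisms `J` of `T*M` with `Π(θ, η) = g̃(Jθ, η)` (see `cometric_endo`), which
is `♭_g ∘ ♯_Π`. -/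
def endo (g : BilinField I M) (P : BivectorField I M) (θ : OneForm I M) : OneForm I M :=
  fun x => g x (P x (θ x))

theorem cometric_endo [FiniteDimensional ℝ E] [IsManifold I ∞ M] {g : BilinField I M} {q : ℕ}
    (hg : IsPseudoRiemannian I g q) (P : BivectorField I M) (θ η : OneForm I M) (x : M) :
    cometric g x (endo g P θ x) (η x) = pair P θ η x := by
  let f : E →L[ℝ] E →L[ℝ] ℝ := g x
  have hinj : Function.Injective f.toLinearMap := by
    rw [injective_iff_map_eq_zero]
    intro v hv
    refine hg.nondegenerate x v fun w => ?_
    exact congrArg (fun l : E →L[ℝ] ℝ => l w) hv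
  have hdim : Module.finrank ℝ E = Module.finrank ℝ (E →L[ℝ] ℝ) := by
    rw [← (LinearMap.toContinuousLinearMap : (E →ₗ[ℝ] ℝ) ≃ₗ[ℝ] _).finrank_eq]
    exact Subspace.dual_finrank_eq.symm
  let e : E ≃L[ℝ] (E →L[ℝ] ℝ) :=
    (LinearEquiv.ofInjectiveOfFinrankEq f.toLinearMap hinj hdim).toContinuousLinearEquiv
  have hfe : f = (e : E →L[ℝ] (E →L[ℝ] ℝ)) := by
    ext v w
    rfl
  have h1 : ∀ v : E, f.inverse (f v) = v := fun v => by
    rw [hfe, ContinuousLinearMap.inverse_equiv]; simp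
  have h2 : ∀ α : E →L[ℝ] ℝ, f (f.inverse α) = α := fun α => by
    rw [hfe, ContinuousLinearMap.inverse_equiv]; simp
  have key : ∀ (v : E) (α : E →L[ℝ] ℝ), f (f.inverse (f v)) (f.inverse α) = α v := fun v α => by
    have hs : f v (f.inverse α) = f (f.inverse α) v := hg.symm x v (f.inverse α)
    rw [h1, hs, h2]
  exact key (P x (θ x)) (η x)

/-! ### The bracket of one-forms and the contravariant Levi-Civita connection -/

/-- The Lie derivative `L_X η`, evaluated on a vector field `Y`:
`(L_X η)(Y) = X(η(Y)) - η([X, Y])`. -/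
def lieDerivForm (X : VectorFieldOn I M) (η : OneForm I M) (Y : VectorFieldOn I M) : M → ℝ :=
  fun x => differential I (fun y => η y (Y y)) x (X x) - η x (VectorField.mlieBracket I X Y x)

/-- The bracket `[θ, η]_Π = L_{♯θ} η - L_{♯η} θ - d(Π(θ, η))` of one-forms, evaluated on a vector
field `Y`. -/
def formBracket (P : BivectorField I M) (θ η : OneForm I M) (Y : VectorFieldOn I M) : M → ℝ :=
  fun x => lieDerivForm (sharp P θ) η Y x - lieDerivForm (sharp P η) θ Y x
    - differential I (pair P θ η) x (Y x)

/-- The contravariant derivative `D_θ u = ♯θ(u)` of a function. -/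
def derivFun (P : BivectorField I M) (θ : OneForm I M) (u : M → ℝ) : M → ℝ :=
  fun x => differential I u x (sharp P θ x)

/-- `D` (written `D θ η` for `D_θ η`) is a contravariant connection for the bivector field `P`:
on one-forms that are smooth on an open set `U` it is, on `U`, additive in both arguments,
function-linear in the first and satisfies the Leibniz rule in the second, and its values are
smooth. The values of `D` on forms that are not smooth near a point are irrelevant. -/
structure IsContravariantConnection [IsManifold I ∞ M] (P : BivectorField I M)
    (D : OneForm I M → OneForm I M → OneForm I M) : Prop where
  smooth : ∀ U : Set M, IsOpen U → ∀ θ η, SmoothForm I U θ → SmoothForm I U η →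
    SmoothForm I U (D θ η)
  add_left : ∀ U : Set M, IsOpen U → ∀ θ θ' η, SmoothForm I U θ → SmoothForm I U θ' →
    SmoothForm I U η → ∀ x ∈ U, D (θ + θ') η x = D θ η x + D θ' η x
  smul_left : ∀ U : Set M, IsOpen U → ∀ (f : M → ℝ) (θ η), ContMDiffOn I 𝓘(ℝ, ℝ) ∞ f U →
    SmoothForm I U θ → SmoothForm I U η → ∀ x ∈ U, D (f • θ) η x = f x • D θ η x
  add_right : ∀ U : Set M, IsOpen U → ∀ θ η η', SmoothForm I U θ → SmoothForm I U η →
    SmoothForm I U η' → ∀ x ∈ U, D θ (η + η') x = D θ η x + D θ η' x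
  leibniz : ∀ U : Set M, IsOpen U → ∀ (f : M → ℝ) (θ η), ContMDiffOn I 𝓘(ℝ, ℝ) ∞ f U →
    SmoothForm I U θ → SmoothForm I U η →
    ∀ x ∈ U, D θ (f • η) x = f x • D θ η x + derivFun P θ f x • η x

/-- `D` is the contravariant Levi-Civita connection of `(g̃, Π)`, with `g̃` the cometric of `g`: the
contravariant connection that is torsion-free, `D_θ η - D_η θ = [θ, η]_Π`, and compatible with the
cometric, `♯θ (g̃(η, γ)) = g̃(D_θ η, γ) + g̃(η, D_θ γ)`. -/
structure IsLeviCivita [IsManifold I ∞ M] (P : BivectorField I M) (g : BilinField I M)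
    (D : OneForm I M → OneForm I M → OneForm I M) : Prop
    extends IsContravariantConnection P D where
  torsion_free : ∀ U : Set M, IsOpen U → ∀ θ η, SmoothForm I U θ → SmoothForm I U η →
    ∀ Y : VectorFieldOn I M, SmoothField I U Y → ∀ x ∈ U,
    D θ η x (Y x) - D η θ x (Y x) = formBracket P θ η Y x
  metric : ∀ U : Set M, IsOpen U → ∀ θ η γ, SmoothForm I U θ → SmoothForm I U η →
    SmoothForm I U γ → ∀ x ∈ U,
    derivFun P θ (fun y => cometric g y (η y) (γ y)) x =
      cometric g x (D θ η x) (γ x) + cometric g x (η x) (D θ γ x)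

/-- The second contravariant derivative `D²_{θ,η} u = D_θ (D_η u) - D_{D_θ η} u` of a function. -/
def secondDeriv (P : BivectorField I M) (D : OneForm I M → OneForm I M → OneForm I M)
    (θ η : OneForm I M) (u : M → ℝ) : M → ℝ :=
  fun x => derivFun P θ (derivFun P η u) x - derivFun P (D θ η) u x

/-- The contravariant Laplacian `Δ^D u = - ∑ᵢ D²_{eᵢ,eᵢ} u` of a function, with respect to a local
orthonormal coframe `e`. (No signs `g̃(eᵢ, eᵢ)` enter the sum.) -/
def laplacian (P : BivectorField I M) (D : OneForm I M → OneForm I M → OneForm I M)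
    {ι : Type*} [Fintype ι] (e : ι → OneForm I M) (u : M → ℝ) : M → ℝ :=
  fun x => -∑ i, secondDeriv P D (e i) (e i) u x

end General

/-! ### Products -/

section Product

variable {E₁ : Type*} [NormedAddCommGroup E₁] [NormedSpace ℝ E₁]
  {H₁ : Type*} [TopologicalSpace H₁] {I₁ : ModelWithCorners ℝ E₁ H₁}
  {M₁ : Type*} [TopologicalSpace M₁] [ChartedSpace H₁ M₁]
  {E₂ : Type*} [NormedAddCommGroup E₂] [NormedSpace ℝ E₂]
  {H₂ : Type*} [TopologicalSpace H₂] {I₂ : ModelWithCorners ℝ E₂ H₂}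
  {M₂ : Type*} [TopologicalSpace M₂] [ChartedSpace H₂ M₂]

variable (I₁ I₂) in
/-- The derivative of the projection `π₁ : M₁ × M₂ → M₁`. -/
def dπ₁ (p : M₁ × M₂) : TangentSpace (I₁.prod I₂) p →L[ℝ] TangentSpace I₁ p.1 :=
  mfderiv (I₁.prod I₂) I₁ Prod.fst p

variable (I₁ I₂) in
/-- The derivative of the projection `π₂ : M₁ × M₂ → M₂`. -/
def dπ₂ (p : M₁ × M₂) : TangentSpace (I₁.prod I₂) p →L[ℝ] TangentSpace I₂ p.2 :=
  mfderiv (I₁.prod I₂) I₂ Prod.snd p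

variable (I₁ I₂) in
/-- The horizontal lift of tangent vectors of `M₁` to `p`: the derivative of `x ↦ (x, p.2)`. -/
def hLiftVec (p : M₁ × M₂) : TangentSpace I₁ p.1 →L[ℝ] TangentSpace (I₁.prod I₂) p :=
  mfderiv I₁ (I₁.prod I₂) (fun x : M₁ => ((x, p.2) : M₁ × M₂)) p.1

variable (I₁ I₂) in
/-- The vertical lift of tangent vectors of `M₂` to `p`: the derivative of `y ↦ (p.1, y)`. -/
def vLiftVec (p : M₁ × M₂) : TangentSpace I₂ p.2 →L[ℝ] TangentSpace (I₁.prod I₂) p :=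
  mfderiv I₂ (I₁.prod I₂) (fun y : M₂ => ((p.1, y) : M₁ × M₂)) p.2

variable (I₂ M₂) in
/-- The horizontal lift `θ^h = π₁^* θ` of a one-form on `M₁`. -/
def hLift (θ : OneForm I₁ M₁) : OneForm (I₁.prod I₂) (M₁ × M₂) :=
  fun p => (θ p.1).comp (dπ₁ I₁ I₂ p)

variable (I₁ M₁) in
/-- The vertical lift `θ^v = π₂^* θ` of a one-form on `M₂`. -/
def vLift (θ : OneForm I₂ M₂) : OneForm (I₁.prod I₂) (M₁ × M₂) :=
  fun p => (θ p.2).comp (dπ₂ I₁ I₂ p)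

/-- The warped metric `π₁^* g₁ + (f^h)² π₂^* g₂` on `M₁ × M₂`. -/
def warpedMetric (g₁ : BilinField I₁ M₁) (g₂ : BilinField I₂ M₂) (f : M₁ → ℝ) :
    BilinField (I₁.prod I₂) (M₁ × M₂) :=
  fun p => ((dπ₁ I₁ I₂ p).precomp ℝ).comp ((g₁ p.1).comp (dπ₁ I₁ I₂ p))
    + (f p.1) ^ 2 • ((dπ₂ I₁ I₂ p).precomp ℝ).comp ((g₂ p.2).comp (dπ₂ I₁ I₂ p))

/-- The warped bivector field `Π^ν = Π₁ + ν Π₂` on `M₁ × M₂`. -/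
def warpedBivector (P₁ : BivectorField I₁ M₁) (P₂ : BivectorField I₂ M₂) (ν : M₁ → ℝ) :
    BivectorField (I₁.prod I₂) (M₁ × M₂) :=
  fun p =>
    ((hLiftVec I₁ I₂ p).comp (P₁ p.1)).comp
      ((hLiftVec I₁ I₂ p).precomp ℝ)
    + ν p.1 • ((vLiftVec I₁ I₂ p).comp (P₂ p.2)).comp
      ((vLiftVec I₁ I₂ p).precomp ℝ)

/-- The coframe `{dx₁^h, …, dx_{k₁}^h, f^h dy₁^v, …, f^h dy_{k₂}^v}` on `M₁ × M₂` built from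
coframes `dx` of `M₁` and `dy` of `M₂`. -/
def warpedCoframe {k₁ k₂ : ℕ} (f : M₁ → ℝ) (dx : Fin k₁ → OneForm I₁ M₁)
    (dy : Fin k₂ → OneForm I₂ M₂) :
    Fin k₁ ⊕ Fin k₂ → OneForm (I₁.prod I₂) (M₁ × M₂) :=
  Sum.elim (fun i => hLift I₂ M₂ (dx i)) (fun j => fun p => f p.1 • vLift I₁ M₁ (dy j) p)

end Product

end ContravariantWarped

end

open ContravariantWarped

noncomputable section

namespace ContravariantWarped

/-! ### Lie brackets of related vector fields -/

section Related

open VectorField Set Filter Topology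

variable {E : Type*} [NormedAddCommGroup E] [NormedSpace ℝ E]
  {H : Type*} [TopologicalSpace H] {I : ModelWithCorners ℝ E H}
  {M : Type*} [TopologicalSpace M] [ChartedSpace H M]
  {E' : Type*} [NormedAddCommGroup E'] [NormedSpace ℝ E']
  {H' : Type*} [TopologicalSpace H'] {I' : ModelWithCorners ℝ E' H'}
  {M' : Type*} [TopologicalSpace M'] [ChartedSpace H' M']

theorem two_le_smooth : (2 : WithTop ℕ∞) ≤ ∞ :=
  WithTop.coe_le_coe.2 (le_top : (2 : ℕ∞) ≤ ⊤)

/-- The vector field `V` read in the chart at `x`. -/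
def chartField (x : M) (V : VectorFieldOn I M) : E → E :=
  mpullbackWithin 𝓘(ℝ, E) I (extChartAt I x).symm V (range I)

theorem mfderivWithin_symm_chartField [IsManifold I 1 M] (x : M) (V : VectorFieldOn I M) {y : E}
    (hy : y ∈ (extChartAt I x).target) :
    mfderivWithin 𝓘(ℝ, E) I (extChartAt I x).symm (range I) y (chartField (E := E) x V y) =
      V ((extChartAt I x).symm y) :=
  (isInvertible_mfderivWithin_extChartAt_symm (I := I) hy).self_apply_inverse _

theorem chartField_extChartAt [IsManifold I 1 M] (x : M) (V : VectorFieldOn I M) {z : M}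
    (hz : z ∈ (extChartAt I x).source) :
    chartField x V (extChartAt I x z) = mfderiv I 𝓘(ℝ, E) (extChartAt I x) z (V z) := by
  have hy := (extChartAt I x).map_source hz
  have h1 := mfderivWithin_symm_chartField x V hy
  have h2 := mfderiv_extChartAt_comp_mfderivWithin_extChartAt_symm (I := I) (x := x) hy
  have h3 := DFunLike.congr_fun h2 (chartField x V (extChartAt I x z))
  change mfderiv I 𝓘(ℝ, E) (extChartAt I x) ((extChartAt I x).symm (extChartAt I x z))
    (mfderivWithin 𝓘(ℝ, E) I (extChartAt I x).symm (range I) (extChartAt I x z)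
      (chartField (E := E) x V (extChartAt I x z))) = _ at h3
  rw [h1] at h3
  have h4 : ∀ w, w = z → mfderiv I 𝓘(ℝ, E) (extChartAt I x) w (V w) =
      mfderiv I 𝓘(ℝ, E) (extChartAt I x) z (V z) := by rintro w rfl; rfl
  exact h3.symm.trans (h4 _ ((extChartAt I x).left_inv hz))

theorem mfderiv_extChartAt_mlieBracket [I.Boundaryless] [IsManifold I 1 M] (x : M)
    (V W : VectorFieldOn I M) :
    mfderiv I 𝓘(ℝ, E) (extChartAt I x) x (mlieBracket I V W x) =
      lieBracket ℝ (E := E) (chartField x V) (chartField x W) (extChartAt I x x) := by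
  have h : mlieBracket I V W x = (mfderiv I 𝓘(ℝ, E) (extChartAt I x) x).inverse
      (lieBracketWithin ℝ (E := E) (chartField x V) (chartField x W)
        ((extChartAt I x).symm ⁻¹' univ ∩ range I) (extChartAt I x x)) := rfl
  rw [h, preimage_univ, univ_inter, I.range_eq_univ, lieBracketWithin_univ]
  exact (isInvertible_mfderiv_extChartAt (I := I)
    (mem_extChartAt_source x)).self_apply_inverse _

theorem differentiableAt_chartField [CompleteSpace E] [I.Boundaryless] [IsManifold I 2 M] {x : M}
    {V : VectorFieldOn I M}
    (hV : MDifferentiableAt I I.tangent (fun y => (⟨y, V y⟩ : TangentBundle I M)) x) :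
    DifferentiableAt ℝ (chartField x V) (extChartAt I x x) := by
  have h := MDifferentiableWithinAt.differentiableWithinAt_mpullbackWithin_vectorField
    (mdifferentiableWithinAt_univ.2 hV)
  have hs : (extChartAt I x).symm ⁻¹' univ ∩ range I = univ := by
    rw [preimage_univ, univ_inter, I.range_eq_univ]
  rw [hs] at h
  exact differentiableWithinAt_univ.1 h

/-- Lie brackets of `φ`-related vector fields are `φ`-related. -/
theorem mfderiv_mlieBracket_of_related [CompleteSpace E] [CompleteSpace E'] [I.Boundaryless]
    [I'.Boundaryless] [IsManifold I ∞ M] [IsManifold I' ∞ M'] {φ : M → M'} (hφ : ContMDiff I I' ∞ φ)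
    {x : M} {V W : VectorFieldOn I M} {V' W' : VectorFieldOn I' M'}
    (hV : MDifferentiableAt I I.tangent (fun y => (⟨y, V y⟩ : TangentBundle I M)) x)
    (hW : MDifferentiableAt I I.tangent (fun y => (⟨y, W y⟩ : TangentBundle I M)) x)
    (hV' : MDifferentiableAt I' I'.tangent (fun y => (⟨y, V' y⟩ : TangentBundle I' M')) (φ x))
    (hW' : MDifferentiableAt I' I'.tangent (fun y => (⟨y, W' y⟩ : TangentBundle I' M')) (φ x))
    (hVV' : ∀ y, mfderiv I I' φ y (V y) = V' (φ y))
    (hWW' : ∀ y, mfderiv I I' φ y (W y) = W' (φ y)) :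
    mfderiv I I' φ x (mlieBracket I V W x) = mlieBracket I' V' W' (φ x) := by
  have : IsManifold I 2 M := IsManifold.of_le (n := ∞) two_le_smooth
  have : IsManifold I' 2 M' := IsManifold.of_le (n := ∞) two_le_smooth
  have : IsManifold I 1 M := IsManifold.of_le (n := ∞) (by simp)
  have : IsManifold I' 1 M' := IsManifold.of_le (n := ∞) (by simp)
  have hφd : MDifferentiable I I' φ := hφ.mdifferentiable (by simp)
  set φc : E → E' := extChartAt I' (φ x) ∘ φ ∘ (extChartAt I x).symm with hφc
  have hx : (extChartAt I x).symm (extChartAt I x x) = x := extChartAt_to_inv x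
  have hφx : φc (extChartAt I x x) = extChartAt I' (φ x) (φ x) := by simp [hφc]
  have hsmooth : ContDiffAt ℝ ∞ φc (extChartAt I x x) := by
    have := (contMDiffAt_iff.1 (hφ x)).2
    rwa [I.range_eq_univ, contDiffWithinAt_univ] at this
  -- the derivative of `φ` read in charts
  have hderiv : ∀ᶠ y in 𝓝 (extChartAt I x x), y ∈ (extChartAt I x).target ∧
      φ ((extChartAt I x).symm y) ∈ (extChartAt I' (φ x)).source := by
    refine Filter.Eventually.and (extChartAt_target_mem_nhds (I := I) x) ?_
    have hc : ContinuousAt (fun y => φ ((extChartAt I x).symm y)) (extChartAt I x x) :=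
      ContinuousAt.comp (by rw [hx]; exact hφ.continuous.continuousAt)
        (continuousAt_extChartAt_symm x)
    refine hc ?_
    beta_reduce
    rw [hx]
    exact extChartAt_source_mem_nhds (φ x)
  have hcomp : ∀ y, y ∈ (extChartAt I x).target →
      φ ((extChartAt I x).symm y) ∈ (extChartAt I' (φ x)).source → ∀ v : E,
      fderiv ℝ φc y v = mfderiv I' 𝓘(ℝ, E') (extChartAt I' (φ x)) (φ ((extChartAt I x).symm y))
        (mfderiv I I' φ ((extChartAt I x).symm y)
          (mfderivWithin 𝓘(ℝ, E) I (extChartAt I x).symm (range I) y v)) := by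
    intro y hy hy' v
    have d1 : MDifferentiableAt 𝓘(ℝ, E) I (extChartAt I x).symm y := by
      have := (contMDiffWithinAt_extChartAt_symm_range (n := 1) (I := I) x hy)
      rw [I.range_eq_univ, contMDiffWithinAt_univ] at this
      exact this.mdifferentiableAt (by simp)
    have d3 : MDifferentiableAt I' 𝓘(ℝ, E') (extChartAt I' (φ x))
        (φ ((extChartAt I x).symm y)) :=
      mdifferentiableAt_extChartAt (by simpa using hy')
    have d2 := (hφd ((extChartAt I x).symm y)).comp y d1
    rw [← mfderiv_eq_fderiv, I.range_eq_univ, mfderivWithin_univ]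
    rw [hφc, mfderiv_comp y d3 d2, mfderiv_comp y (hφd _) d1]
    rfl
  have hrel : ∀ {X : VectorFieldOn I M} {X' : VectorFieldOn I' M'},
      (∀ y, mfderiv I I' φ y (X y) = X' (φ y)) →
      (fun y => fderiv ℝ φc y (chartField x X y)) =ᶠ[𝓝 (extChartAt I x x)]
        (chartField (φ x) X') ∘ φc := by
    intro X X' h
    filter_upwards [hderiv] with y hy
    rw [hcomp y hy.1 hy.2, mfderivWithin_symm_chartField x X hy.1, h]
    exact (chartField_extChartAt (φ x) X' hy.2).symm
  have dV := differentiableAt_chartField hV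
  have dW := differentiableAt_chartField hW
  have dV' := differentiableAt_chartField hV'
  have dW' := differentiableAt_chartField hW'
  rw [← hφx] at dV' dW'
  have dφc : DifferentiableAt ℝ φc (extChartAt I x x) := hsmooth.differentiableAt (by simp)
  have hbr := fderiv_apply_lieBracket (n := ∞) hsmooth (by simpa using two_le_smooth) dW dV
  rw [(hrel hVV').fderiv_eq, (hrel hWW').fderiv_eq, fderiv_comp _ dW' dφc, fderiv_comp _ dV' dφc,
    ContinuousLinearMap.comp_apply, ContinuousLinearMap.comp_apply] at hbr
  have hV₀ : fderiv ℝ φc (extChartAt I x x) (chartField x V (extChartAt I x x)) =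
      chartField (φ x) V' (φc (extChartAt I x x)) := (hrel hVV').self_of_nhds
  have hW₀ : fderiv ℝ φc (extChartAt I x x) (chartField x W (extChartAt I x x)) =
      chartField (φ x) W' (φc (extChartAt I x x)) := (hrel hWW').self_of_nhds
  rw [hV₀, hW₀, hφx] at hbr
  have hchain : ∀ v : TangentSpace I x,
      fderiv ℝ φc (extChartAt I x x) (mfderiv I 𝓘(ℝ, E) (extChartAt I x) x v) =
      mfderiv I' 𝓘(ℝ, E') (extChartAt I' (φ x)) (φ x) (mfderiv I I' φ x v) := by
    intro v
    have d1 : MDifferentiableAt I 𝓘(ℝ, E) (extChartAt I x) x :=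
      mdifferentiableAt_extChartAt (mem_chart_source H x)
    have d2 : MDifferentiableAt I' 𝓘(ℝ, E') (extChartAt I' (φ x)) (φ x) :=
      mdifferentiableAt_extChartAt (mem_chart_source H' (φ x))
    have heq : φc ∘ extChartAt I x =ᶠ[𝓝 x] extChartAt I' (φ x) ∘ φ := by
      filter_upwards [extChartAt_source_mem_nhds (I := I) x] with z hz
      simp only [hφc, Function.comp_apply, (extChartAt I x).left_inv hz]
    have h1 := mfderiv_comp x dφc.mdifferentiableAt d1
    rw [heq.mfderiv_eq, mfderiv_comp x d2 (hφd x), mfderiv_eq_fderiv] at h1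
    exact (DFunLike.congr_fun h1 v).symm
  apply (isInvertible_mfderiv_extChartAt (I := I') (mem_extChartAt_source (φ x))).injective
  rw [← hchain, mfderiv_extChartAt_mlieBracket, mfderiv_extChartAt_mlieBracket]
  exact hbr

end Related

section General

variable {E : Type*} [NormedAddCommGroup E] [NormedSpace ℝ E]
  {H : Type*} [TopologicalSpace H] {I : ModelWithCorners ℝ E H}
  {M : Type*} [TopologicalSpace M] [ChartedSpace H M] [IsManifold I ∞ M]

theorem SmoothField.mdifferentiableAt {U : Set M} {X : VectorFieldOn I M} (hX : SmoothField I U X)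
    (hU : IsOpen U) {x : M} (hx : x ∈ U) :
    MDifferentiableAt I I.tangent (fun y => (⟨y, X y⟩ : TangentBundle I M)) x :=
  (hX.contMDiffAt (hU.mem_nhds hx)).mdifferentiableAt (by simp)

theorem SmoothForm.contMDiffOn_apply {U : Set M} {θ : OneForm I M} (hθ : SmoothForm I U θ)
    {X : VectorFieldOn I M} (hX : SmoothField I U X) :
    ContMDiffOn I 𝓘(ℝ, ℝ) ∞ (fun x => θ x (X x)) U := by
  intro x hx
  have h := ContMDiffWithinAt.clm_bundle_apply (F₁ := E) (F₂ := ℝ)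
    (E₁ := fun x : M => TangentSpace I x) (E₂ := Bundle.Trivial M ℝ) (hθ x hx) (hX x hx)
  exact Bundle.contMDiffWithinAt_section.1 h

theorem SmoothForm.smul {U : Set M} {θ : OneForm I M} (hθ : SmoothForm I U θ) {f : M → ℝ}
    (hf : ContMDiffOn I 𝓘(ℝ, ℝ) ∞ f U) : SmoothForm I U (fun x => f x • θ x) := by
  exact ContMDiffOn.smul_section hf hθ

theorem SmoothField.smul {U : Set M} {X : VectorFieldOn I M} (hX : SmoothField I U X) {f : M → ℝ}
    (hf : ContMDiffOn I 𝓘(ℝ, ℝ) ∞ f U) : SmoothField I U (fun x => f x • X x) := by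
  exact ContMDiffOn.smul_section hf hX

theorem SmoothForm.mono {U V : Set M} {θ : OneForm I M} (hθ : SmoothForm I U θ) (h : V ⊆ U) :
    SmoothForm I V θ := ContMDiffOn.mono hθ h

/-- The derivative of a smooth function along a smooth field is smooth. -/
theorem SmoothField.contMDiffOn_differential_apply {U : Set M} {X : VectorFieldOn I M}
    (hX : SmoothField I U X) {u : M → ℝ} (hu : ContMDiff I 𝓘(ℝ, ℝ) ∞ u) :
    ContMDiffOn I 𝓘(ℝ, ℝ) ∞ (fun x => differential I u x (X x)) U := by
  have h1 : ContMDiff I.tangent 𝓘(ℝ, ℝ).tangent ∞ (tangentMap I 𝓘(ℝ, ℝ) u) :=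
    hu.contMDiff_tangentMap (by simp)
  exact ((contMDiff_snd_tangentBundle_modelSpace ℝ 𝓘(ℝ, ℝ)).comp h1).comp_contMDiffOn hX

/-- Every tangent vector extends to a smooth field on a neighbourhood. -/
theorem exists_smoothField_eq {U : Set M} (hU : IsOpen U) {x : M} (hx : x ∈ U)
    (v : TangentSpace I x) :
    ∃ V ⊆ U, IsOpen V ∧ x ∈ V ∧ ∃ Y : VectorFieldOn I M, SmoothField I V Y ∧ Y x = v := by
  obtain ⟨s, hs, hY⟩ := FiberBundle.exists_contMDiffOn_extend (k := ∞) I E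
    (V := fun y : M => TangentSpace I y) v
  refine ⟨U ∩ interior s, Set.inter_subset_left, hU.inter isOpen_interior,
    ⟨hx, mem_interior_iff_mem_nhds.2 hs⟩, _,
    ContMDiffOn.mono hY (Set.inter_subset_right.trans interior_subset), ?_⟩
  exact FiberBundle.extend_apply_self (F := E) v

end General

section Product

variable {E₁ : Type*} [NormedAddCommGroup E₁] [NormedSpace ℝ E₁]
  {H₁ : Type*} [TopologicalSpace H₁] {I₁ : ModelWithCorners ℝ E₁ H₁}
  {M₁ : Type*} [TopologicalSpace M₁] [ChartedSpace H₁ M₁]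
  {E₂ : Type*} [NormedAddCommGroup E₂] [NormedSpace ℝ E₂]
  {H₂ : Type*} [TopologicalSpace H₂] {I₂ : ModelWithCorners ℝ E₂ H₂}
  {M₂ : Type*} [TopologicalSpace M₂] [ChartedSpace H₂ M₂]

/-! ### Lifts to a product -/

@[simp] theorem dπ₁_hLiftVec (p : M₁ × M₂) (v : TangentSpace I₁ p.1) :
    dπ₁ I₁ I₂ p (hLiftVec I₁ I₂ p v) = v := by
  rw [dπ₁, hLiftVec, mfderiv_fst, mfderiv_prod_left]; rfl

@[simp] theorem dπ₂_hLiftVec (p : M₁ × M₂) (v : TangentSpace I₁ p.1) :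
    dπ₂ I₁ I₂ p (hLiftVec I₁ I₂ p v) = 0 := by
  rw [dπ₂, hLiftVec, mfderiv_snd, mfderiv_prod_left]; rfl

@[simp] theorem dπ₁_vLiftVec (p : M₁ × M₂) (w : TangentSpace I₂ p.2) :
    dπ₁ I₁ I₂ p (vLiftVec I₁ I₂ p w) = 0 := by
  rw [dπ₁, vLiftVec, mfderiv_fst, mfderiv_prod_right]; rfl

@[simp] theorem dπ₂_vLiftVec (p : M₁ × M₂) (w : TangentSpace I₂ p.2) :
    dπ₂ I₁ I₂ p (vLiftVec I₁ I₂ p w) = w := by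
  rw [dπ₂, vLiftVec, mfderiv_snd, mfderiv_prod_right]; rfl

theorem hLiftVec_add_vLiftVec (p : M₁ × M₂) (z : TangentSpace (I₁.prod I₂) p) :
    hLiftVec I₁ I₂ p (dπ₁ I₁ I₂ p z) + vLiftVec I₁ I₂ p (dπ₂ I₁ I₂ p z) = z := by
  rw [dπ₁, dπ₂, hLiftVec, vLiftVec, mfderiv_fst, mfderiv_snd, mfderiv_prod_left,
    mfderiv_prod_right]
  change ((z : E₁ × E₂).1, (0 : E₂)) + ((0 : E₁), (z : E₁ × E₂).2) = (z : E₁ × E₂)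
  exact Prod.ext (add_zero _) (zero_add _)

variable (I₂ M₂) in
/-- The horizontal lift of a vector field on `M₁`. -/
def hField (X : VectorFieldOn I₁ M₁) : VectorFieldOn (I₁.prod I₂) (M₁ × M₂) :=
  fun p => hLiftVec I₁ I₂ p (X p.1)

variable (I₁ M₁) in
/-- The vertical lift of a vector field on `M₂`. -/
def vField (X : VectorFieldOn I₂ M₂) : VectorFieldOn (I₁.prod I₂) (M₁ × M₂) :=
  fun p => vLiftVec I₁ I₂ p (X p.2)

section Smooth

variable [IsManifold I₁ ∞ M₁] [IsManifold I₂ ∞ M₂]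

theorem SmoothField.hField {U : Set M₁} {X : VectorFieldOn I₁ M₁} (hX : SmoothField I₁ U X)
    (V : Set M₂) : SmoothField (I₁.prod I₂) (U ×ˢ V) (hField I₂ M₂ X) := by
  have h1 : ContMDiffOn (I₁.prod I₂) (I₁.tangent.prod I₂.tangent) ∞
      (fun p : M₁ × M₂ => ((⟨p.1, X p.1⟩ : TangentBundle I₁ M₁),
        (⟨p.2, 0⟩ : TangentBundle I₂ M₂))) (U ×ˢ V) :=
    (hX.comp contMDiff_fst.contMDiffOn fun p hp => hp.1).prodMk
      (((Bundle.contMDiff_zeroSection ℝ (fun y : M₂ => TangentSpace I₂ y)).comp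
        contMDiff_snd).contMDiffOn)
  refine ((contMDiff_equivTangentBundleProd_symm (n := ∞)).comp_contMDiffOn h1).congr ?_
  intro p _
  change (⟨p, _⟩ : TangentBundle (I₁.prod I₂) (M₁ × M₂)) = ⟨p, _⟩
  congr 1
  rw [ContravariantWarped.hField, hLiftVec, mfderiv_prod_left]
  rfl

theorem SmoothField.vField {V : Set M₂} {X : VectorFieldOn I₂ M₂} (hX : SmoothField I₂ V X)
    (U : Set M₁) : SmoothField (I₁.prod I₂) (U ×ˢ V) (vField I₁ M₁ X) := by
  have h1 : ContMDiffOn (I₁.prod I₂) (I₁.tangent.prod I₂.tangent) ∞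
      (fun p : M₁ × M₂ => ((⟨p.1, 0⟩ : TangentBundle I₁ M₁),
        (⟨p.2, X p.2⟩ : TangentBundle I₂ M₂))) (U ×ˢ V) :=
    (((Bundle.contMDiff_zeroSection ℝ (fun y : M₁ => TangentSpace I₁ y)).comp
        contMDiff_fst).contMDiffOn).prodMk
      (hX.comp contMDiff_snd.contMDiffOn fun p hp => hp.2)
  refine ((contMDiff_equivTangentBundleProd_symm (n := ∞)).comp_contMDiffOn h1).congr ?_
  intro p _
  change (⟨p, _⟩ : TangentBundle (I₁.prod I₂) (M₁ × M₂)) = ⟨p, _⟩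
  congr 1
  rw [ContravariantWarped.vField, vLiftVec, mfderiv_prod_right]
  rfl

end Smooth

end Product

section Pullback

variable {E : Type*} [NormedAddCommGroup E] [NormedSpace ℝ E]
  {H : Type*} [TopologicalSpace H] {I : ModelWithCorners ℝ E H}
  {M : Type*} [TopologicalSpace M] [ChartedSpace H M]
  {E' : Type*} [NormedAddCommGroup E'] [NormedSpace ℝ E']
  {H' : Type*} [TopologicalSpace H'] {I' : ModelWithCorners ℝ E' H'}
  {M' : Type*} [TopologicalSpace M'] [ChartedSpace H' M']
  [IsManifold I ∞ M] [IsManifold I' ∞ M']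

/-- The pull-back of a smooth one-form along a smooth map is smooth. -/
theorem SmoothForm.pullback {φ : M → M'} (hφ : ContMDiff I I' ∞ φ) {U : Set M'}
    (hU : IsOpen U) {θ : OneForm I' M'} (hθ : SmoothForm I' U θ) :
    SmoothForm I (φ ⁻¹' U) (fun x => (θ (φ x)).comp (mfderiv I I' φ x)) := by
  intro x hx
  have hθx := contMDiffAt_hom_bundle _ |>.1 (ContMDiffOn.contMDiffAt hθ (hU.mem_nhds hx))
  have hd := ContMDiffAt.mfderiv_const (m := ∞) (hφ x) (by simp)
  refine ContMDiffAt.contMDiffWithinAt ((contMDiffAt_hom_bundle _).2 ⟨contMDiffAt_id, ?_⟩)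
  refine ((hθx.2.comp x (hφ x)).clm_comp hd).congr_of_eventuallyEq ?_
  have hb := (trivializationAt E' (TangentSpace I') (φ x)).open_baseSet.mem_nhds
    (FiberBundle.mem_baseSet_trivializationAt' (φ x))
  filter_upwards [hφ.continuous.continuousAt hb] with y hy
  ext v
  simp only [inTangentCoordinates, ContinuousLinearMap.inCoordinates,
    ContinuousLinearMap.comp_apply, Function.comp_apply, id]
  congr 2
  exact (((trivializationAt E' (TangentSpace I') (φ x)).symmL_continuousLinearMapAt hy _)).symm

end Pullback

section General

variable {E : Type*} [NormedAddCommGroup E] [NormedSpace ℝ E]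
  {H : Type*} [TopologicalSpace H] {I : ModelWithCorners ℝ E H}
  {M : Type*} [TopologicalSpace M] [ChartedSpace H M]

/-! ### Pointwise metric algebra -/

/-- The bilinear form of `g` at `x` is symmetric and nondegenerate. -/
structure IsMetricAt (g : BilinField I M) (x : M) : Prop where
  symm : ∀ v w, g x v w = g x w v
  nondegenerate : ∀ v, (∀ w, g x v w = 0) → v = 0

theorem IsPseudoRiemannian.isMetricAt [IsManifold I ∞ M] {g : BilinField I M} {q : ℕ}
    (hg : IsPseudoRiemannian I g q) (x : M) : IsMetricAt g x :=
  ⟨hg.symm x, hg.nondegenerate x⟩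

namespace IsMetricAt

variable {g : BilinField I M} {x : M}

theorem cometric_comm (hg : IsMetricAt g x) (α β : TangentSpace I x →L[ℝ] ℝ) :
    cometric g x α β = cometric g x β α := hg.symm _ _

variable [FiniteDimensional ℝ E]

theorem isInvertible (hg : IsMetricAt g x) : ContinuousLinearMap.IsInvertible (g x) := by
  let f : E →L[ℝ] E →L[ℝ] ℝ := g x
  have hinj : Function.Injective f.toLinearMap := by
    rw [injective_iff_map_eq_zero]
    exact fun v hv => hg.nondegenerate v fun w => congrArg (fun l : E →L[ℝ] ℝ => l w) hv
  have hdim : Module.finrank ℝ E = Module.finrank ℝ (E →L[ℝ] ℝ) := by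
    rw [← (LinearMap.toContinuousLinearMap : (E →ₗ[ℝ] ℝ) ≃ₗ[ℝ] _).finrank_eq]
    exact Subspace.dual_finrank_eq.symm
  exact ⟨(LinearEquiv.ofInjectiveOfFinrankEq f.toLinearMap hinj hdim).toContinuousLinearEquiv,
    by ext v w; rfl⟩

theorem flat_musicalSharp (hg : IsMetricAt g x) (α : TangentSpace I x →L[ℝ] ℝ) :
    g x (musicalSharp g x α) = α :=
  hg.isInvertible.self_apply_inverse α

theorem musicalSharp_flat (hg : IsMetricAt g x) (v : TangentSpace I x) :
    musicalSharp g x (g x v) = v :=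
  hg.isInvertible.inverse_apply_self v

theorem cometric_eq (hg : IsMetricAt g x) (α β : TangentSpace I x →L[ℝ] ℝ) :
    cometric g x α β = β (musicalSharp g x α) := by
  rw [cometric, hg.symm, hg.flat_musicalSharp]

theorem cometric_eq' (hg : IsMetricAt g x) (α β : TangentSpace I x →L[ℝ] ℝ) :
    cometric g x α β = α (musicalSharp g x β) := by
  rw [hg.cometric_comm, hg.cometric_eq]

/-- A covector that vanishes on the vectors dual to an orthonormal coframe is zero. -/
theorem eq_zero_of_apply_musicalSharp (hg : IsMetricAt g x) {ι : Type*} [Fintype ι]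
    (hι : Fintype.card ι = Module.finrank ℝ E) {e : ι → TangentSpace I x →L[ℝ] ℝ} {ε : ι → ℝ}
    (hε : ∀ i, ε i ≠ 0) [DecidableEq ι]
    (he : ∀ i j, cometric g x (e i) (e j) = if i = j then ε i else 0)
    {α : TangentSpace I x →L[ℝ] ℝ} (hα : ∀ j, α (musicalSharp g x (e j)) = 0) : α = 0 := by
  let b : ι → E := fun i => musicalSharp g x (e i)
  have hb : ∀ i j, e j (b i) = if i = j then ε i else 0 := fun i j => by
    rw [← he, hg.cometric_eq]
  have hli : LinearIndependent ℝ b := by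
    rw [Fintype.linearIndependent_iff]
    intro c hc j
    have h : e j (∑ i, c i • b i) = c j * ε j := by
      refine (map_sum (e j) _ _).trans ?_
      rw [Finset.sum_eq_single j]
      · exact ((e j).map_smul (c j) (b j)).trans (by rw [hb, if_pos rfl, smul_eq_mul])
      · intro i _ hij
        exact ((e j).map_smul (c i) (b i)).trans (by rw [hb, if_neg hij, smul_zero])
      · simp
    have h0 : c j * ε j = 0 := h.symm.trans ((congrArg (e j) hc).trans (map_zero (e j)))
    exact (mul_eq_zero.1 h0).resolve_right (hε j)
  have hspan := hli.span_eq_top_of_card_eq_finrank' hι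
  have h : (α : E →L[ℝ] ℝ).toLinearMap = 0 := by
    refine LinearMap.ext_on_range (v := b) hspan fun j => ?_
    exact hα j
  ext v
  exact DFunLike.congr_fun h v

end IsMetricAt

theorem IsOrthonormalCoframe.apply_musicalSharp_ext [FiniteDimensional ℝ E] [IsManifold I ∞ M]
    {g : BilinField I M} {q k : ℕ} {U : Set M} {e : Fin k → OneForm I M}
    (he : IsOrthonormalCoframe g q U e) (hk : k = Module.finrank ℝ E) {x : M} (hx : x ∈ U)
    (hg : IsMetricAt g x) {α β : TangentSpace I x →L[ℝ] ℝ}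
    (h : ∀ j, α (musicalSharp g x (e j x)) = β (musicalSharp g x (e j x))) : α = β := by
  refine sub_eq_zero.1 (hg.eq_zero_of_apply_musicalSharp (by simpa using hk)
    (ε := fun i : Fin k => if (i : ℕ) < q then -1 else 1) (fun i => ?_)
    (he.orthonormal x hx) fun j => ?_)
  · split_ifs <;> norm_num
  · rw [sub_apply, h, sub_self]

/-! ### The Koszul formula along forms of constant length -/

theorem differential_const (c : ℝ) (x : M) : differential I (fun _ => c) x = 0 :=
  mvfderiv_const c

theorem differential_congr {u v : M → ℝ} {x : M} (h : u =ᶠ[nhds x] v) :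
    differential I u x = differential I v x := by
  have := h.mfderiv_eq (I := I) (I' := 𝓘(ℝ, ℝ))
  have h' := h.self_of_nhds
  ext w
  exact DFunLike.congr_fun this w

theorem differential_eq_zero {u : M → ℝ} {U : Set M} (hU : IsOpen U) {c : ℝ}
    (h : ∀ x ∈ U, u x = c) {x : M} (hx : x ∈ U) : differential I u x = 0 := by
  rw [differential_congr (v := fun _ => c) (Filter.eventually_of_mem (hU.mem_nhds hx) h),
    differential_const]

/-- The diagonal Koszul formula for forms with constant inner products. -/
theorem IsLeviCivita.apply_musicalSharp [FiniteDimensional ℝ E] [IsManifold I ∞ M]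
    {P : BivectorField I M} {g : BilinField I M} {D : OneForm I M → OneForm I M → OneForm I M}
    (hD : IsLeviCivita P g D) {U : Set M} (hU : IsOpen U) {θ γ : OneForm I M}
    (hθ : SmoothForm I U θ) (hγ : SmoothForm I U γ) {c c' : ℝ}
    (hc : ∀ x ∈ U, cometric g x (θ x) (θ x) = c) (hc' : ∀ x ∈ U, cometric g x (θ x) (γ x) = c')
    {Y : VectorFieldOn I M} (hY : SmoothField I U Y) {x : M} (hx : x ∈ U) (hg : IsMetricAt g x)
    (hYx : Y x = musicalSharp g x (θ x)) :
    D θ θ x (musicalSharp g x (γ x)) = formBracket P γ θ Y x := by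
  have h1 := hD.metric U hU θ θ γ hθ hθ hγ x hx
  have h2 := hD.metric U hU γ θ θ hγ hθ hθ x hx
  have h3 := hD.torsion_free U hU γ θ hγ hθ Y hY x hx
  rw [derivFun, differential_eq_zero hU hc' hx, zero_apply,
    hg.cometric_eq' (D θ θ x), hg.cometric_eq (θ x)] at h1
  rw [derivFun, differential_eq_zero hU hc hx, zero_apply,
    hg.cometric_eq', hg.cometric_eq] at h2
  rw [hYx] at h3
  linarith

theorem endo_apply_musicalSharp [FiniteDimensional ℝ E] {P : BivectorField I M}
    {g : BilinField I M} {x : M} (hg : IsMetricAt g x) (θ : OneForm I M)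
    (α : TangentSpace I x →L[ℝ] ℝ) :
    endo g P θ x (musicalSharp g x α) = α (P x (θ x)) := by
  rw [endo, hg.symm, hg.flat_musicalSharp]

end General

section Product

variable {E₁ : Type*} [NormedAddCommGroup E₁] [NormedSpace ℝ E₁]
  {H₁ : Type*} [TopologicalSpace H₁] {I₁ : ModelWithCorners ℝ E₁ H₁}
  {M₁ : Type*} [TopologicalSpace M₁] [ChartedSpace H₁ M₁]
  {E₂ : Type*} [NormedAddCommGroup E₂] [NormedSpace ℝ E₂]
  {H₂ : Type*} [TopologicalSpace H₂] {I₂ : ModelWithCorners ℝ E₂ H₂}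
  {M₂ : Type*} [TopologicalSpace M₂] [ChartedSpace H₂ M₂]

@[simp] theorem hLift_apply (θ : OneForm I₁ M₁) (p : M₁ × M₂)
    (z : TangentSpace (I₁.prod I₂) p) : hLift I₂ M₂ θ p z = θ p.1 (dπ₁ I₁ I₂ p z) := rfl

@[simp] theorem vLift_apply (θ : OneForm I₂ M₂) (p : M₁ × M₂)
    (z : TangentSpace (I₁.prod I₂) p) : vLift I₁ M₁ θ p z = θ p.2 (dπ₂ I₁ I₂ p z) := rfl

theorem SmoothForm.hLift [IsManifold I₁ ∞ M₁] [IsManifold I₂ ∞ M₂] {U : Set M₁} (hU : IsOpen U)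
    {θ : OneForm I₁ M₁} (hθ : SmoothForm I₁ U θ) (V : Set M₂) :
    SmoothForm (I₁.prod I₂) (U ×ˢ V) (hLift I₂ M₂ θ) :=
  (hθ.pullback (contMDiff_fst (I := I₁) (J := I₂) (N := M₂)) hU).mono fun _ hp => hp.1

theorem SmoothForm.vLift [IsManifold I₁ ∞ M₁] [IsManifold I₂ ∞ M₂] {V : Set M₂} (hV : IsOpen V)
    {θ : OneForm I₂ M₂} (hθ : SmoothForm I₂ V θ) (U : Set M₁) :
    SmoothForm (I₁.prod I₂) (U ×ˢ V) (vLift I₁ M₁ θ) :=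
  (hθ.pullback (contMDiff_snd (I := I₁) (J := I₂) (M := M₁)) hV).mono fun _ hp => hp.2

/-! ### The warped metric and bivector on lifts -/

theorem warpedMetric_apply (g₁ : BilinField I₁ M₁) (g₂ : BilinField I₂ M₂) (f : M₁ → ℝ)
    (p : M₁ × M₂) (z z' : TangentSpace (I₁.prod I₂) p) :
    warpedMetric g₁ g₂ f p z z' = g₁ p.1 (dπ₁ I₁ I₂ p z) (dπ₁ I₁ I₂ p z')
      + f p.1 ^ 2 * g₂ p.2 (dπ₂ I₁ I₂ p z) (dπ₂ I₁ I₂ p z') := rfl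

theorem warpedBivector_apply (P₁ : BivectorField I₁ M₁) (P₂ : BivectorField I₂ M₂) (ν : M₁ → ℝ)
    (p : M₁ × M₂) (α : TangentSpace (I₁.prod I₂) p →L[ℝ] ℝ) :
    warpedBivector P₁ P₂ ν p α = hLiftVec I₁ I₂ p (P₁ p.1 (α.comp (hLiftVec I₁ I₂ p)))
      + ν p.1 • vLiftVec I₁ I₂ p (P₂ p.2 (α.comp (vLiftVec I₁ I₂ p))) := rfl

theorem warpedBivector_comp (P₁ : BivectorField I₁ M₁) (P₂ : BivectorField I₂ M₂) (ν : M₁ → ℝ)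
    (p : M₁ × M₂) (α : TangentSpace I₁ p.1 →L[ℝ] ℝ) (β : TangentSpace I₂ p.2 →L[ℝ] ℝ) :
    warpedBivector P₁ P₂ ν p (α.comp (dπ₁ I₁ I₂ p) + β.comp (dπ₂ I₁ I₂ p)) =
      hLiftVec I₁ I₂ p (P₁ p.1 α) + ν p.1 • vLiftVec I₁ I₂ p (P₂ p.2 β) := by
  rw [warpedBivector_apply]
  congr 4 <;> ext v <;> simp

theorem sharp_warpedBivector_hLift (P₁ : BivectorField I₁ M₁) (P₂ : BivectorField I₂ M₂)
    (ν : M₁ → ℝ) (θ : OneForm I₁ M₁) :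
    sharp (warpedBivector P₁ P₂ ν) (hLift I₂ M₂ θ) = hField I₂ M₂ (sharp P₁ θ) := by
  funext p
  have h := warpedBivector_comp P₁ P₂ ν p (θ p.1) 0
  rw [ContinuousLinearMap.zero_comp, add_zero, map_zero, map_zero, smul_zero, add_zero] at h
  exact h

theorem sharp_warpedBivector_smul_vLift (P₁ : BivectorField I₁ M₁) (P₂ : BivectorField I₂ M₂)
    (ν f : M₁ → ℝ) (η : OneForm I₂ M₂) :
    sharp (warpedBivector P₁ P₂ ν) (fun p => f p.1 • vLift I₁ M₁ η p) =
      fun p => (ν p.1 * f p.1) • vField I₁ M₁ (sharp P₂ η) p := by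
  funext p
  have h := warpedBivector_comp P₁ P₂ ν p 0 (η p.2)
  rw [ContinuousLinearMap.zero_comp, zero_add, map_zero, map_zero, zero_add] at h
  rw [sharp, map_smul, mul_comm, mul_smul]
  exact congrArg _ h

section Metric

variable {g₁ : BilinField I₁ M₁}
  {g₂ : BilinField I₂ M₂} {f : M₁ → ℝ} {p : M₁ × M₂}

theorem IsMetricAt.warpedMetric (h₁ : IsMetricAt g₁ p.1) (h₂ : IsMetricAt g₂ p.2)
    (hf : f p.1 ≠ 0) : IsMetricAt (warpedMetric g₁ g₂ f) p where
  symm z z' := by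
    rw [warpedMetric_apply, warpedMetric_apply, h₁.symm, h₂.symm]
  nondegenerate z hz := by
    have hz₁ : dπ₁ I₁ I₂ p z = 0 := h₁.nondegenerate _ fun v => by
      simpa [warpedMetric_apply] using hz (hLiftVec I₁ I₂ p v)
    have hz₂ : dπ₂ I₁ I₂ p z = 0 := h₂.nondegenerate _ fun v => by
      simpa [warpedMetric_apply, hf] using hz (vLiftVec I₁ I₂ p v)
    rw [← hLiftVec_add_vLiftVec p z, hz₁, hz₂, map_zero, map_zero, add_zero]

variable [FiniteDimensional ℝ E₁] [FiniteDimensional ℝ E₂]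

theorem musicalSharp_warpedMetric_hLift (h₁ : IsMetricAt g₁ p.1) (h₂ : IsMetricAt g₂ p.2)
    (hf : f p.1 ≠ 0) (θ : OneForm I₁ M₁) :
    musicalSharp (warpedMetric g₁ g₂ f) p (hLift I₂ M₂ θ p) =
      hLiftVec I₁ I₂ p (musicalSharp g₁ p.1 (θ p.1)) := by
  rw [← (h₁.warpedMetric h₂ hf).musicalSharp_flat (hLiftVec I₁ I₂ p _)]
  congr 1
  ext z
  rw [warpedMetric_apply, dπ₁_hLiftVec, dπ₂_hLiftVec, h₁.flat_musicalSharp, map_zero,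
    zero_apply, mul_zero, add_zero, hLift_apply]

theorem musicalSharp_warpedMetric_vLift (h₁ : IsMetricAt g₁ p.1) (h₂ : IsMetricAt g₂ p.2)
    (hf : f p.1 ≠ 0) (η : OneForm I₂ M₂) :
    musicalSharp (warpedMetric g₁ g₂ f) p (f p.1 • vLift I₁ M₁ η p) =
      vLiftVec I₁ I₂ p ((f p.1)⁻¹ • musicalSharp g₂ p.2 (η p.2)) := by
  rw [← (h₁.warpedMetric h₂ hf).musicalSharp_flat (vLiftVec I₁ I₂ p _)]
  congr 1
  ext z
  rw [warpedMetric_apply, dπ₁_vLiftVec, dπ₂_vLiftVec, map_smul, h₂.flat_musicalSharp, map_zero,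
    zero_apply, zero_add, smul_apply,
    smul_apply, vLift_apply, smul_eq_mul, smul_eq_mul]
  field_simp

theorem cometric_warpedMetric_hLift_hLift (h₁ : IsMetricAt g₁ p.1) (h₂ : IsMetricAt g₂ p.2)
    (hf : f p.1 ≠ 0) (θ η : OneForm I₁ M₁) :
    cometric (warpedMetric g₁ g₂ f) p (hLift I₂ M₂ θ p) (hLift I₂ M₂ η p) =
      cometric g₁ p.1 (θ p.1) (η p.1) := by
  rw [(h₁.warpedMetric h₂ hf).cometric_eq, musicalSharp_warpedMetric_hLift h₁ h₂ hf, hLift_apply,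
    dπ₁_hLiftVec, h₁.cometric_eq]

theorem cometric_warpedMetric_hLift_vLift (h₁ : IsMetricAt g₁ p.1) (h₂ : IsMetricAt g₂ p.2)
    (hf : f p.1 ≠ 0) (θ : OneForm I₁ M₁) (η : OneForm I₂ M₂) :
    cometric (warpedMetric g₁ g₂ f) p (hLift I₂ M₂ θ p) (f p.1 • vLift I₁ M₁ η p) = 0 := by
  rw [(h₁.warpedMetric h₂ hf).cometric_eq, musicalSharp_warpedMetric_hLift h₁ h₂ hf,
    smul_apply, vLift_apply, dπ₂_hLiftVec, map_zero, smul_zero]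

theorem cometric_warpedMetric_vLift_vLift (h₁ : IsMetricAt g₁ p.1) (h₂ : IsMetricAt g₂ p.2)
    (hf : f p.1 ≠ 0) (θ η : OneForm I₂ M₂) :
    cometric (warpedMetric g₁ g₂ f) p (f p.1 • vLift I₁ M₁ θ p) (f p.1 • vLift I₁ M₁ η p) =
      cometric g₂ p.2 (θ p.2) (η p.2) := by
  rw [(h₁.warpedMetric h₂ hf).cometric_eq, musicalSharp_warpedMetric_vLift h₁ h₂ hf,
    smul_apply, vLift_apply, dπ₂_vLiftVec, map_smul, h₂.cometric_eq,
    smul_smul, mul_inv_cancel₀ hf, one_smul]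

end Metric

end Product

section Product

variable {E₁ : Type*} [NormedAddCommGroup E₁] [NormedSpace ℝ E₁]
  {H₁ : Type*} [TopologicalSpace H₁] {I₁ : ModelWithCorners ℝ E₁ H₁}
  {M₁ : Type*} [TopologicalSpace M₁] [ChartedSpace H₁ M₁]
  {E₂ : Type*} [NormedAddCommGroup E₂] [NormedSpace ℝ E₂]
  {H₂ : Type*} [TopologicalSpace H₂] {I₂ : ModelWithCorners ℝ E₂ H₂}
  {M₂ : Type*} [TopologicalSpace M₂] [ChartedSpace H₂ M₂]

/-! ### Differentials of products of lifted functions -/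

theorem differential_fst_mul_snd {a : M₁ → ℝ} {b : M₂ → ℝ} {p : M₁ × M₂}
    (ha : MDifferentiableAt I₁ 𝓘(ℝ, ℝ) a p.1) (hb : MDifferentiableAt I₂ 𝓘(ℝ, ℝ) b p.2)
    (z : TangentSpace (I₁.prod I₂) p) :
    differential (I₁.prod I₂) (fun p : M₁ × M₂ => a p.1 * b p.2) p z =
      b p.2 * differential I₁ a p.1 (dπ₁ I₁ I₂ p z)
        + a p.1 * differential I₂ b p.2 (dπ₂ I₁ I₂ p z) := by
  have h₁ := mvfderiv_comp_apply p ha (mdifferentiableAt_fst (I := I₁) (I' := I₂)) z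
  have h₂ := mvfderiv_comp_apply p hb (mdifferentiableAt_snd (I := I₁) (I' := I₂)) z
  have h := mvfderiv_mul (ha.comp p (mdifferentiableAt_fst (I := I₁) (I' := I₂)))
    (hb.comp p (mdifferentiableAt_snd (I := I₁) (I' := I₂)))
  have h' := DFunLike.congr_fun h z
  refine h'.trans ?_
  simp only [add_apply, smul_apply, smul_eq_mul, Function.comp_apply, h₁, h₂]
  rw [add_comm]
  rfl

theorem differential_fst {a : M₁ → ℝ} {p : M₁ × M₂}
    (ha : MDifferentiableAt I₁ 𝓘(ℝ, ℝ) a p.1) (z : TangentSpace (I₁.prod I₂) p) :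
    differential (I₁.prod I₂) (fun p : M₁ × M₂ => a p.1) p z =
      differential I₁ a p.1 (dπ₁ I₁ I₂ p z) :=
  mvfderiv_comp_apply p ha (mdifferentiableAt_fst (I := I₁) (I' := I₂)) z

theorem differential_snd {b : M₂ → ℝ} {p : M₁ × M₂}
    (hb : MDifferentiableAt I₂ 𝓘(ℝ, ℝ) b p.2) (z : TangentSpace (I₁.prod I₂) p) :
    differential (I₁.prod I₂) (fun p : M₁ × M₂ => b p.2) p z =
      differential I₂ b p.2 (dπ₂ I₁ I₂ p z) :=
  mvfderiv_comp_apply p hb (mdifferentiableAt_snd (I := I₁) (I' := I₂)) z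

/-! ### Lie brackets of lifts -/

section Brackets

open VectorField

variable [IsManifold I₁ ∞ M₁] [IsManifold I₂ ∞ M₂]
  [CompleteSpace E₁] [CompleteSpace E₂] {U : Set M₁} {V : Set M₂}
  {X Y : VectorFieldOn I₁ M₁} {Z W : VectorFieldOn I₂ M₂} {p : M₁ × M₂}

theorem mdifferentiableAt_zero_field {E : Type*} [NormedAddCommGroup E] [NormedSpace ℝ E]
    {H : Type*} [TopologicalSpace H] {I : ModelWithCorners ℝ E H}
    {M : Type*} [TopologicalSpace M] [ChartedSpace H M] [IsManifold I ∞ M] (x : M) :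
    MDifferentiableAt I I.tangent (fun y => (⟨y, 0⟩ : TangentBundle I M)) x :=
  (Bundle.contMDiff_zeroSection ℝ (fun y : M => TangentSpace I y) (n := 1) (IB := I)
    (F := E)).mdifferentiable (by simp) x

theorem mlieBracket_smul_vField {φ : M₁ → ℝ} (hφ : MDifferentiableAt I₁ 𝓘(ℝ, ℝ) φ p.1)
    (hV : IsOpen V) (hZ : SmoothField I₂ V Z) (hp : p.2 ∈ V)
    (T : VectorFieldOn (I₁.prod I₂) (M₁ × M₂)) :
    mlieBracket (I₁.prod I₂) (fun p => φ p.1 • vField I₁ M₁ Z p) T p =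
      -differential I₁ φ p.1 (dπ₁ I₁ I₂ p (T p)) • vField I₁ M₁ Z p
        + φ p.1 • mlieBracket (I₁.prod I₂) (vField I₁ M₁ Z) T p := by
  have : IsManifold (I₁.prod I₂) 2 (M₁ × M₂) := IsManifold.of_le (n := ∞) two_le_smooth
  have h := mlieBracket_smul_left (I := I₁.prod I₂) (x := p) (W := T)
    (hφ.comp p (mdifferentiableAt_fst (I := I₁) (I' := I₂)))
    ((hZ.vField (I₁ := I₁) Set.univ).mdifferentiableAt (isOpen_univ.prod hV) ⟨trivial, hp⟩)
  rw [← differential_fst hφ]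
  exact h

variable [I₁.Boundaryless] [I₂.Boundaryless]

theorem dπ₁_mlieBracket_hField_hField (hU : IsOpen U) (hX : SmoothField I₁ U X)
    (hY : SmoothField I₁ U Y) (hp : p.1 ∈ U) :
    dπ₁ I₁ I₂ p (mlieBracket (I₁.prod I₂) (hField I₂ M₂ X) (hField I₂ M₂ Y) p) =
      mlieBracket I₁ X Y p.1 :=
  mfderiv_mlieBracket_of_related contMDiff_fst
    ((hX.hField Set.univ).mdifferentiableAt (hU.prod isOpen_univ) ⟨hp, trivial⟩)
    ((hY.hField Set.univ).mdifferentiableAt (hU.prod isOpen_univ) ⟨hp, trivial⟩)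
    (hX.mdifferentiableAt hU hp) (hY.mdifferentiableAt hU hp)
    (fun q => dπ₁_hLiftVec q _) (fun q => dπ₁_hLiftVec q _)

theorem dπ₂_mlieBracket_vField_vField (hV : IsOpen V) (hZ : SmoothField I₂ V Z)
    (hW : SmoothField I₂ V W) (hp : p.2 ∈ V) :
    dπ₂ I₁ I₂ p (mlieBracket (I₁.prod I₂) (vField I₁ M₁ Z) (vField I₁ M₁ W) p) =
      mlieBracket I₂ Z W p.2 :=
  mfderiv_mlieBracket_of_related contMDiff_snd
    ((hZ.vField Set.univ).mdifferentiableAt (isOpen_univ.prod hV) ⟨trivial, hp⟩)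
    ((hW.vField Set.univ).mdifferentiableAt (isOpen_univ.prod hV) ⟨trivial, hp⟩)
    (hZ.mdifferentiableAt hV hp) (hW.mdifferentiableAt hV hp)
    (fun q => dπ₂_vLiftVec q _) (fun q => dπ₂_vLiftVec q _)

theorem dπ₁_mlieBracket_vField_vField (hV : IsOpen V) (hZ : SmoothField I₂ V Z)
    (hW : SmoothField I₂ V W) (hp : p.2 ∈ V) :
    dπ₁ I₁ I₂ p (mlieBracket (I₁.prod I₂) (vField I₁ M₁ Z) (vField I₁ M₁ W) p) = 0 :=
  (mfderiv_mlieBracket_of_related (V' := 0) (W' := 0) contMDiff_fst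
    ((hZ.vField Set.univ).mdifferentiableAt (isOpen_univ.prod hV) ⟨trivial, hp⟩)
    ((hW.vField Set.univ).mdifferentiableAt (isOpen_univ.prod hV) ⟨trivial, hp⟩)
    (mdifferentiableAt_zero_field _) (mdifferentiableAt_zero_field _)
    (fun q => dπ₁_vLiftVec q _) (fun q => dπ₁_vLiftVec q _)).trans (by simp)

theorem dπ₂_mlieBracket_hField_hField (hU : IsOpen U) (hX : SmoothField I₁ U X)
    (hY : SmoothField I₁ U Y) (hp : p.1 ∈ U) :
    dπ₂ I₁ I₂ p (mlieBracket (I₁.prod I₂) (hField I₂ M₂ X) (hField I₂ M₂ Y) p) = 0 :=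
  (mfderiv_mlieBracket_of_related (V' := 0) (W' := 0) contMDiff_snd
    ((hX.hField Set.univ).mdifferentiableAt (hU.prod isOpen_univ) ⟨hp, trivial⟩)
    ((hY.hField Set.univ).mdifferentiableAt (hU.prod isOpen_univ) ⟨hp, trivial⟩)
    (mdifferentiableAt_zero_field _) (mdifferentiableAt_zero_field _)
    (fun q => dπ₂_hLiftVec q _) (fun q => dπ₂_hLiftVec q _)).trans (by simp)

theorem mlieBracket_hField_vField (hU : IsOpen U) (hV : IsOpen V) (hX : SmoothField I₁ U X)
    (hZ : SmoothField I₂ V Z) (hp : p ∈ U ×ˢ V) :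
    mlieBracket (I₁.prod I₂) (hField I₂ M₂ X) (vField I₁ M₁ Z) p = 0 := by
  have hX' := (hX.hField (I₂ := I₂) V).mdifferentiableAt (hU.prod hV) hp
  have hZ' := (hZ.vField (I₁ := I₁) U).mdifferentiableAt (hU.prod hV) hp
  have h₁ : dπ₁ I₁ I₂ p (mlieBracket (I₁.prod I₂) (hField I₂ M₂ X) (vField I₁ M₁ Z) p) = 0 :=
    (mfderiv_mlieBracket_of_related (V' := X) (W' := 0) contMDiff_fst hX' hZ'
      (hX.mdifferentiableAt hU hp.1) (mdifferentiableAt_zero_field _)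
      (fun q => dπ₁_hLiftVec q _) (fun q => dπ₁_vLiftVec q _)).trans (by simp)
  have h₂ : dπ₂ I₁ I₂ p (mlieBracket (I₁.prod I₂) (hField I₂ M₂ X) (vField I₁ M₁ Z) p) = 0 :=
    (mfderiv_mlieBracket_of_related (V' := 0) (W' := Z) contMDiff_snd hX' hZ'
      (mdifferentiableAt_zero_field _) (hZ.mdifferentiableAt hV hp.2)
      (fun q => dπ₂_hLiftVec q _) (fun q => dπ₂_vLiftVec q _)).trans (by simp)
  rw [← hLiftVec_add_vLiftVec p (mlieBracket _ _ _ p), h₁, h₂, map_zero, map_zero, add_zero]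

/-! ### Brackets of lifted one-forms -/

variable {θ η : OneForm I₁ M₁} {α β : OneForm I₂ M₂}

theorem lieDerivForm_hField_hLift (hU : IsOpen U) (hX : SmoothField I₁ U X)
    (hη : SmoothForm I₁ U η) (hY : SmoothField I₁ U Y) (hp : p.1 ∈ U) :
    lieDerivForm (hField I₂ M₂ X) (hLift I₂ M₂ η) (hField I₂ M₂ Y) p =
      lieDerivForm X η Y p.1 := by
  have h : (fun q : M₁ × M₂ => hLift I₂ M₂ η q (hField I₂ M₂ Y q)) =
      fun q => (fun x => η x (Y x)) q.1 := by
    funext q; rw [hLift_apply, hField, dπ₁_hLiftVec]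
  have hd := ((hη.contMDiffOn_apply hY).contMDiffAt (hU.mem_nhds hp)).mdifferentiableAt (by simp)
  rw [lieDerivForm, h, differential_fst hd, hLift_apply,
    dπ₁_mlieBracket_hField_hField hU hX hY hp, hField, dπ₁_hLiftVec, lieDerivForm]

theorem lieDerivForm_smul_vField_smul_vLift {φ f : M₁ → ℝ}
    (hφ : MDifferentiableAt I₁ 𝓘(ℝ, ℝ) φ p.1) (hf : MDifferentiableAt I₁ 𝓘(ℝ, ℝ) f p.1)
    (hV : IsOpen V) (hZ : SmoothField I₂ V Z) (hα : SmoothForm I₂ V α)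
    (hW : SmoothField I₂ V W) (hp : p.2 ∈ V) :
    lieDerivForm (fun p => φ p.1 • vField I₁ M₁ Z p) (fun p => f p.1 • vLift I₁ M₁ α p)
      (vField I₁ M₁ W) p = φ p.1 * f p.1 * lieDerivForm Z α W p.2 := by
  have h : (fun q : M₁ × M₂ => (f q.1 • vLift I₁ M₁ α q) (vField I₁ M₁ W q)) =
      fun q => f q.1 * (fun y => α y (W y)) q.2 := by
    funext q; rw [smul_apply, vLift_apply, vField, dπ₂_vLiftVec, smul_eq_mul]
  have hd := ((hα.contMDiffOn_apply hW).contMDiffAt (hV.mem_nhds hp)).mdifferentiableAt (by simp)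
  have hT : dπ₁ I₁ I₂ p (vField I₁ M₁ W p) = 0 := dπ₁_vLiftVec p _
  have hZp₁ : dπ₁ I₁ I₂ p (vField I₁ M₁ Z p) = 0 := dπ₁_vLiftVec p _
  have hZp₂ : dπ₂ I₁ I₂ p (vField I₁ M₁ Z p) = Z p.2 := dπ₂_vLiftVec p _
  rw [lieDerivForm, h, differential_fst_mul_snd hf hd, mlieBracket_smul_vField hφ hV hZ hp,
    lieDerivForm]
  simp only [hT, map_smul, hZp₁, hZp₂, map_zero, neg_zero, zero_smul, zero_add, smul_zero,
    smul_apply, vLift_apply, dπ₂_mlieBracket_vField_vField hV hZ hW hp, smul_eq_mul, mul_zero]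
  ring

theorem lieDerivForm_hField_smul_vLift_vField {f : M₁ → ℝ}
    (hf : MDifferentiableAt I₁ 𝓘(ℝ, ℝ) f p.1) (hU : IsOpen U) (hV : IsOpen V)
    (hX : SmoothField I₁ U X) (hα : SmoothForm I₂ V α) (hW : SmoothField I₂ V W)
    (hp : p ∈ U ×ˢ V) :
    lieDerivForm (hField I₂ M₂ X) (fun p => f p.1 • vLift I₁ M₁ α p) (vField I₁ M₁ W) p =
      α p.2 (W p.2) * differential I₁ f p.1 (X p.1) := by
  have h : (fun q : M₁ × M₂ => (f q.1 • vLift I₁ M₁ α q) (vField I₁ M₁ W q)) =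
      fun q => f q.1 * (fun y => α y (W y)) q.2 := by
    funext q; rw [smul_apply, vLift_apply, vField, dπ₂_vLiftVec, smul_eq_mul]
  have hd := ((hα.contMDiffOn_apply hW).contMDiffAt
    (hV.mem_nhds hp.2)).mdifferentiableAt (by simp)
  rw [lieDerivForm, h, differential_fst_mul_snd hf hd, mlieBracket_hField_vField hU hV hX hW hp,
    hField, dπ₁_hLiftVec, dπ₂_hLiftVec, map_zero, map_zero, mul_zero, add_zero, sub_zero]

theorem lieDerivForm_hField_smul_vLift_hField {f : M₁ → ℝ} (hU : IsOpen U)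
    (hX : SmoothField I₁ U X) (hY : SmoothField I₁ U Y) (α : OneForm I₂ M₂) (hp : p.1 ∈ U) :
    lieDerivForm (hField I₂ M₂ X) (fun p => f p.1 • vLift I₁ M₁ α p) (hField I₂ M₂ Y) p = 0 := by
  have h : (fun q : M₁ × M₂ => (f q.1 • vLift I₁ M₁ α q) (hField I₂ M₂ Y q)) = fun _ => 0 := by
    funext q; rw [smul_apply, vLift_apply, hField, dπ₂_hLiftVec, map_zero, smul_zero]
  rw [lieDerivForm, h, differential_const, smul_apply, vLift_apply,
    dπ₂_mlieBracket_hField_hField hU hX hY hp, map_zero, smul_zero, zero_apply, sub_zero]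

theorem lieDerivForm_smul_vField_hLift_hField {φ : M₁ → ℝ}
    (hφ : MDifferentiableAt I₁ 𝓘(ℝ, ℝ) φ p.1) (hU : IsOpen U) (hV : IsOpen V)
    (hZ : SmoothField I₂ V Z) (hη : SmoothForm I₁ U η) (hY : SmoothField I₁ U Y)
    (hp : p ∈ U ×ˢ V) :
    lieDerivForm (fun p => φ p.1 • vField I₁ M₁ Z p) (hLift I₂ M₂ η) (hField I₂ M₂ Y) p = 0 := by
  have h : (fun q : M₁ × M₂ => hLift I₂ M₂ η q (hField I₂ M₂ Y q)) =
      fun q => (fun x => η x (Y x)) q.1 := by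
    funext q; rw [hLift_apply, hField, dπ₁_hLiftVec]
  have hd := ((hη.contMDiffOn_apply hY).contMDiffAt
    (hU.mem_nhds hp.1)).mdifferentiableAt (by simp)
  have hZp₁ : dπ₁ I₁ I₂ p (vField I₁ M₁ Z p) = 0 := dπ₁_vLiftVec p _
  rw [lieDerivForm, h, differential_fst hd, hLift_apply, mlieBracket_smul_vField hφ hV hZ hp.2,
    mlieBracket_swap_apply, mlieBracket_hField_vField hU hV hY hZ hp, neg_zero, smul_zero, add_zero]
  simp only [map_smul, hZp₁, smul_zero, map_zero, sub_zero]

theorem lieDerivForm_smul_vField_hLift_vField {φ : M₁ → ℝ}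
    (hφ : MDifferentiableAt I₁ 𝓘(ℝ, ℝ) φ p.1) (hV : IsOpen V) (hZ : SmoothField I₂ V Z)
    (η : OneForm I₁ M₁) (hW : SmoothField I₂ V W) (hp : p.2 ∈ V) :
    lieDerivForm (fun p => φ p.1 • vField I₁ M₁ Z p) (hLift I₂ M₂ η) (vField I₁ M₁ W) p = 0 := by
  have h : (fun q : M₁ × M₂ => hLift I₂ M₂ η q (vField I₁ M₁ W q)) = fun _ => 0 := by
    funext q; rw [hLift_apply, vField, dπ₁_vLiftVec, map_zero]
  have hZp₁ : dπ₁ I₁ I₂ p (vField I₁ M₁ Z p) = 0 := dπ₁_vLiftVec p _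
  rw [lieDerivForm, h, differential_const, hLift_apply, mlieBracket_smul_vField hφ hV hZ hp]
  simp only [map_add, map_smul, hZp₁, dπ₁_mlieBracket_vField_vField hV hZ hW hp, smul_zero,
    add_zero, map_zero, zero_apply, sub_zero]

end Brackets

section FormBrackets

variable [IsManifold I₁ ∞ M₁] [IsManifold I₂ ∞ M₂] [I₁.Boundaryless] [I₂.Boundaryless]
  [CompleteSpace E₁] [CompleteSpace E₂] {U : Set M₁} {V : Set M₂}
  {P₁ : BivectorField I₁ M₁} {P₂ : BivectorField I₂ M₂} {ν f : M₁ → ℝ}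
  {θ η : OneForm I₁ M₁} {α β : OneForm I₂ M₂}
  {Y : VectorFieldOn I₁ M₁} {W : VectorFieldOn I₂ M₂} {p : M₁ × M₂}

theorem pair_eq_sharp {E : Type*} [NormedAddCommGroup E] [NormedSpace ℝ E]
    {H : Type*} [TopologicalSpace H] {I : ModelWithCorners ℝ E H}
    {M : Type*} [TopologicalSpace M] [ChartedSpace H M] (P : BivectorField I M)
    (θ η : OneForm I M) (x : M) : pair P θ η x = η x (sharp P θ x) := rfl

theorem formBracket_hLift_hLift (hP₁ : IsBivector P₁) (P₂ : BivectorField I₂ M₂) (ν : M₁ → ℝ)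
    (hU : IsOpen U) (hθ : SmoothForm I₁ U θ) (hη : SmoothForm I₁ U η) (hY : SmoothField I₁ U Y)
    (hp : p.1 ∈ U) :
    formBracket (warpedBivector P₁ P₂ ν) (hLift I₂ M₂ θ) (hLift I₂ M₂ η) (hField I₂ M₂ Y) p =
      formBracket P₁ θ η Y p.1 := by
  have hsθ := hP₁.smooth U hU θ hθ
  have hsη := hP₁.smooth U hU η hη
  have h : pair (warpedBivector P₁ P₂ ν) (hLift I₂ M₂ θ) (hLift I₂ M₂ η) =
      fun p => pair P₁ θ η p.1 := by
    funext q
    rw [pair_eq_sharp, sharp_warpedBivector_hLift, hLift_apply, hField, dπ₁_hLiftVec]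
    rfl
  have hd : MDifferentiableAt I₁ 𝓘(ℝ, ℝ) (pair P₁ θ η) p.1 :=
    ((hη.contMDiffOn_apply hsθ).contMDiffAt (hU.mem_nhds hp)).mdifferentiableAt (by simp)
  rw [formBracket, h, sharp_warpedBivector_hLift, sharp_warpedBivector_hLift,
    lieDerivForm_hField_hLift hU hsθ hη hY hp, lieDerivForm_hField_hLift hU hsη hθ hY hp,
    differential_fst hd, hField, dπ₁_hLiftVec, formBracket]

theorem formBracket_smul_vLift_hLift (hP₁ : IsBivector P₁) (hP₂ : IsBivector P₂)
    (hν : MDifferentiableAt I₁ 𝓘(ℝ, ℝ) ν p.1) (hf : MDifferentiableAt I₁ 𝓘(ℝ, ℝ) f p.1)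
    (hU : IsOpen U) (hV : IsOpen V) (hα : SmoothForm I₂ V α) (hη : SmoothForm I₁ U η)
    (hY : SmoothField I₁ U Y) (hp : p ∈ U ×ˢ V) :
    formBracket (warpedBivector P₁ P₂ ν) (fun p => f p.1 • vLift I₁ M₁ α p) (hLift I₂ M₂ η)
      (hField I₂ M₂ Y) p = 0 := by
  have h : pair (warpedBivector P₁ P₂ ν) (fun p => f p.1 • vLift I₁ M₁ α p) (hLift I₂ M₂ η) =
      fun _ => 0 := by
    funext q
    rw [pair_eq_sharp, sharp_warpedBivector_smul_vLift, hLift_apply, map_smul, vField,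
      dπ₁_vLiftVec, smul_zero, map_zero]
  rw [formBracket, h, sharp_warpedBivector_hLift, sharp_warpedBivector_smul_vLift,
    lieDerivForm_smul_vField_hLift_hField (φ := fun x => ν x * f x) (hν.mul hf) hU hV
      (hP₂.smooth V hV α hα) hη hY hp,
    lieDerivForm_hField_smul_vLift_hField hU (hP₁.smooth U hU η hη) hY α hp.1,
    differential_const, zero_apply, sub_zero, sub_zero]

theorem formBracket_hLift_smul_vLift (hP₁ : IsBivector P₁) (hP₂ : IsBivector P₂)
    (hν : MDifferentiableAt I₁ 𝓘(ℝ, ℝ) ν p.1) (hf : MDifferentiableAt I₁ 𝓘(ℝ, ℝ) f p.1)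
    (hU : IsOpen U) (hV : IsOpen V) (hα : SmoothForm I₂ V α) (hη : SmoothForm I₁ U η)
    (hW : SmoothField I₂ V W) (hp : p ∈ U ×ˢ V) :
    formBracket (warpedBivector P₁ P₂ ν) (hLift I₂ M₂ η) (fun p => f p.1 • vLift I₁ M₁ α p)
      (vField I₁ M₁ W) p = α p.2 (W p.2) * differential I₁ f p.1 (sharp P₁ η p.1) := by
  have h : pair (warpedBivector P₁ P₂ ν) (hLift I₂ M₂ η) (fun p => f p.1 • vLift I₁ M₁ α p) =
      fun _ => 0 := by
    funext q
    rw [pair_eq_sharp, sharp_warpedBivector_hLift, smul_apply, vLift_apply, hField,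
      dπ₂_hLiftVec, map_zero, smul_zero]
  rw [formBracket, h, sharp_warpedBivector_hLift, sharp_warpedBivector_smul_vLift,
    lieDerivForm_hField_smul_vLift_vField hf hU hV (hP₁.smooth U hU η hη) hα hW hp,
    lieDerivForm_smul_vField_hLift_vField (φ := fun x => ν x * f x) (hν.mul hf) hV
      (hP₂.smooth V hV α hα) η hW hp.2,
    differential_const, zero_apply, sub_zero, sub_zero]

theorem formBracket_smul_vLift_smul_vLift (P₁ : BivectorField I₁ M₁) (hP₂ : IsBivector P₂)
    (hν : MDifferentiableAt I₁ 𝓘(ℝ, ℝ) ν p.1) (hf : MDifferentiableAt I₁ 𝓘(ℝ, ℝ) f p.1)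
    (hV : IsOpen V) (hα : SmoothForm I₂ V α) (hβ : SmoothForm I₂ V β)
    (hW : SmoothField I₂ V W) (hp : p.2 ∈ V) :
    formBracket (warpedBivector P₁ P₂ ν) (fun p => f p.1 • vLift I₁ M₁ α p)
      (fun p => f p.1 • vLift I₁ M₁ β p) (vField I₁ M₁ W) p =
      ν p.1 * f p.1 * f p.1 * formBracket P₂ α β W p.2 := by
  have hsα := hP₂.smooth V hV α hα
  have hsβ := hP₂.smooth V hV β hβ
  have h : pair (warpedBivector P₁ P₂ ν) (fun p => f p.1 • vLift I₁ M₁ α p)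
      (fun p => f p.1 • vLift I₁ M₁ β p) =
      fun p => (fun x => ν x * f x * f x) p.1 * pair P₂ α β p.2 := by
    funext q
    rw [pair_eq_sharp, sharp_warpedBivector_smul_vLift, smul_apply, vLift_apply, map_smul, vField,
      dπ₂_vLiftVec, map_smul, smul_eq_mul, smul_eq_mul, pair_eq_sharp P₂]
    ring
  have hd : MDifferentiableAt I₂ 𝓘(ℝ, ℝ) (pair P₂ α β) p.2 :=
    ((hβ.contMDiffOn_apply hsα).contMDiffAt (hV.mem_nhds hp)).mdifferentiableAt (by simp)
  rw [formBracket, h, sharp_warpedBivector_smul_vLift, sharp_warpedBivector_smul_vLift,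
    lieDerivForm_smul_vField_smul_vLift (φ := fun x => ν x * f x) (hν.mul hf) hf hV hsα hβ hW hp,
    lieDerivForm_smul_vField_smul_vLift (φ := fun x => ν x * f x) (hν.mul hf) hf hV hsβ hα hW hp,
    differential_fst_mul_snd (a := fun x => ν x * f x * f x) ((hν.mul hf).mul hf) hd, vField,
    dπ₁_vLiftVec, dπ₂_vLiftVec,
    formBracket, map_zero]
  ring

end FormBrackets

end Product

theorem sum_signs {k q : ℕ} (h : q ≤ k) :
    ∑ i : Fin k, (if (i : ℕ) < q then (-1 : ℝ) else 1) = (k : ℝ) - 2 * q := by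
  rw [Fin.sum_univ_eq_sum_range (fun i => if i < q then (-1 : ℝ) else 1) k,
    ← Finset.sum_range_add_sum_Ico _ h,
    Finset.sum_congr rfl fun i hi => if_pos (Finset.mem_range.1 hi),
    Finset.sum_congr rfl fun i hi => if_neg (Finset.mem_Ico.1 hi).1.not_gt]
  simp [Nat.cast_sub h]
  ring

theorem IsPseudoRiemannian.index_le {E : Type*} [NormedAddCommGroup E] [NormedSpace ℝ E]
    [FiniteDimensional ℝ E] {H : Type*} [TopologicalSpace H] {I : ModelWithCorners ℝ E H}
    {M : Type*} [TopologicalSpace M] [ChartedSpace H M] [IsManifold I ∞ M] {g : BilinField I M}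
    {q : ℕ} (hg : IsPseudoRiemannian I g q) (x : M) : q ≤ Module.finrank ℝ E := by
  rw [← hg.index x]
  have : Module.Finite ℝ (TangentSpace I x) := inferInstanceAs (Module.Finite ℝ E)
  obtain ⟨V, hV, -⟩ := exists_finrank_eq_sigNeg_and_negDef
    (LinearMap.BilinMap.toQuadraticMap
      ((ContinuousLinearMap.coeLM ℝ).comp (g x).toLinearMap :
        LinearMap.BilinForm ℝ (TangentSpace I x)))
  rw [← hV]
  exact V.finrank_le

section Product

variable {E₁ : Type*} [NormedAddCommGroup E₁] [NormedSpace ℝ E₁]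
  {H₁ : Type*} [TopologicalSpace H₁] {I₁ : ModelWithCorners ℝ E₁ H₁}
  {M₁ : Type*} [TopologicalSpace M₁] [ChartedSpace H₁ M₁]
  {E₂ : Type*} [NormedAddCommGroup E₂] [NormedSpace ℝ E₂]
  {H₂ : Type*} [TopologicalSpace H₂] {I₂ : ModelWithCorners ℝ E₂ H₂}
  {M₂ : Type*} [TopologicalSpace M₂] [ChartedSpace H₂ M₂]

theorem covector_ext {p : M₁ × M₂} {α β : TangentSpace (I₁.prod I₂) p →L[ℝ] ℝ}
    (h₁ : α.comp (hLiftVec I₁ I₂ p) = β.comp (hLiftVec I₁ I₂ p))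
    (h₂ : α.comp (vLiftVec I₁ I₂ p) = β.comp (vLiftVec I₁ I₂ p)) : α = β := by
  ext z
  rw [← hLiftVec_add_vLiftVec p z, map_add, map_add]
  exact congrArg₂ _ (DFunLike.congr_fun h₁ _) (DFunLike.congr_fun h₂ _)

/-! ### The Levi-Civita connection of the warped product along the coframe -/

section Connection

variable [IsManifold I₁ ∞ M₁] [IsManifold I₂ ∞ M₂] [I₁.Boundaryless] [I₂.Boundaryless]
  [FiniteDimensional ℝ E₁] [FiniteDimensional ℝ E₂]
  {k₁ k₂ q₁ q₂ : ℕ} {g₁ : BilinField I₁ M₁} {g₂ : BilinField I₂ M₂}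
  {P₁ : BivectorField I₁ M₁} {P₂ : BivectorField I₂ M₂} {f ν : M₁ → ℝ}
  {D₁ : OneForm I₁ M₁ → OneForm I₁ M₁ → OneForm I₁ M₁}
  {D₂ : OneForm I₂ M₂ → OneForm I₂ M₂ → OneForm I₂ M₂}
  {D : OneForm (I₁.prod I₂) (M₁ × M₂) → OneForm (I₁.prod I₂) (M₁ × M₂) →
    OneForm (I₁.prod I₂) (M₁ × M₂)}
  {U₁ : Set M₁} {U₂ : Set M₂} {dx : Fin k₁ → OneForm I₁ M₁} {dy : Fin k₂ → OneForm I₂ M₂}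
  {p : M₁ × M₂}

theorem connection_hLift_hLift (hk₁ : k₁ = Module.finrank ℝ E₁) (hk₂ : k₂ = Module.finrank ℝ E₂)
    (hg₁ : IsPseudoRiemannian I₁ g₁ q₁) (hg₂ : IsPseudoRiemannian I₂ g₂ q₂)
    (hP₁ : IsBivector P₁) (hP₂ : IsBivector P₂)
    (hf : ContMDiff I₁ 𝓘(ℝ, ℝ) ∞ f) (hf₀ : ∀ x, f x ≠ 0) (hν : ContMDiff I₁ 𝓘(ℝ, ℝ) ∞ ν)
    (hD₁ : IsLeviCivita P₁ g₁ D₁)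
    (hD : IsLeviCivita (warpedBivector P₁ P₂ ν) (warpedMetric g₁ g₂ f) D)
    (hU₁ : IsOpen U₁) (hU₂ : IsOpen U₂) (hdx : IsOrthonormalCoframe g₁ q₁ U₁ dx)
    (hdy : IsOrthonormalCoframe g₂ q₂ U₂ dy) (hp : p ∈ U₁ ×ˢ U₂) (i : Fin k₁) :
    D (hLift I₂ M₂ (dx i)) (hLift I₂ M₂ (dx i)) p =
      (D₁ (dx i) (dx i) p.1).comp (dπ₁ I₁ I₂ p) := by
  obtain ⟨V, hVU, hV, hpV, Y, hY, hYp⟩ := exists_smoothField_eq hU₁ hp.1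
    (musicalSharp g₁ p.1 (dx i p.1))
  have m₁ := fun x => hg₁.isMetricAt x
  have m₂ := fun y => hg₂.isMetricAt y
  have hdxV := fun j => (hdx.smooth j).mono hVU
  have hYhp : hField I₂ M₂ Y p =
      musicalSharp (warpedMetric g₁ g₂ f) p (hLift I₂ M₂ (dx i) p) := by
    rw [musicalSharp_warpedMetric_hLift (m₁ _) (m₂ _) (hf₀ _), hField, hYp]
  have hcc : ∀ j, ∀ q ∈ V ×ˢ U₂, cometric (warpedMetric g₁ g₂ f) q (hLift I₂ M₂ (dx i) q)
      (hLift I₂ M₂ (dx j) q) = if i = j then (if (i : ℕ) < q₁ then -1 else 1) else 0 := by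
    intro j q hq
    rw [cometric_warpedMetric_hLift_hLift (m₁ _) (m₂ _) (hf₀ _),
      hdx.orthonormal _ (hVU hq.1)]
  have key : ∀ γ : OneForm (I₁.prod I₂) (M₁ × M₂), SmoothForm (I₁.prod I₂) (V ×ˢ U₂) γ → ∀ c : ℝ,
      (∀ q ∈ V ×ˢ U₂, cometric (warpedMetric g₁ g₂ f) q (hLift I₂ M₂ (dx i) q) (γ q) = c) →
      D (hLift I₂ M₂ (dx i)) (hLift I₂ M₂ (dx i)) p
        (musicalSharp (warpedMetric g₁ g₂ f) p (γ p)) =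
      formBracket (warpedBivector P₁ P₂ ν) γ (hLift I₂ M₂ (dx i)) (hField I₂ M₂ Y) p :=
    fun γ hγ c hc => hD.apply_musicalSharp (hV.prod hU₂) ((hdxV i).hLift hV U₂) hγ (hcc i) hc
      (hY.hField U₂) ⟨hpV, hp.2⟩ ((m₁ _).warpedMetric (m₂ _) (hf₀ _)) hYhp
  refine covector_ext ?_ ?_
  · refine hdx.apply_musicalSharp_ext hk₁ hp.1 (m₁ _) fun j => ?_
    have h := key _ ((hdxV j).hLift hV U₂) _ (hcc j)
    rw [musicalSharp_warpedMetric_hLift (m₁ _) (m₂ _) (hf₀ _),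
      formBracket_hLift_hLift hP₁ P₂ ν hV (hdxV j) (hdxV i) hY hpV] at h
    have h' := hD₁.apply_musicalSharp hV (hdxV i) (hdxV j)
      (fun x hx => hdx.orthonormal x (hVU hx) i i) (fun x hx => hdx.orthonormal x (hVU hx) i j)
      hY hpV (m₁ _) hYp
    simp only [ContinuousLinearMap.comp_apply, dπ₁_hLiftVec]
    exact h.trans h'.symm
  · refine hdy.apply_musicalSharp_ext hk₂ hp.2 (m₂ _) fun j => ?_
    have h := key (fun q => f q.1 • vLift I₁ M₁ (dy j) q)
      (((hdy.smooth j).vLift hU₂ V).smul (hf.comp contMDiff_fst).contMDiffOn) 0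
      (fun q _ => cometric_warpedMetric_hLift_vLift (m₁ _) (m₂ _) (hf₀ _) _ _)
    rw [musicalSharp_warpedMetric_vLift (m₁ _) (m₂ _) (hf₀ _),
      formBracket_smul_vLift_hLift hP₁ hP₂ (hν.mdifferentiable (by simp) _)
        (hf.mdifferentiable (by simp) _) hV hU₂ (hdy.smooth j) (hdxV i) hY ⟨hpV, hp.2⟩,
      map_smul, map_smul] at h
    simp only [ContinuousLinearMap.comp_apply, dπ₁_vLiftVec, map_zero]
    exact (smul_eq_zero.1 h).resolve_left (inv_ne_zero (hf₀ _))

theorem connection_vLift_vLift (hk₁ : k₁ = Module.finrank ℝ E₁) (hk₂ : k₂ = Module.finrank ℝ E₂)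
    (hg₁ : IsPseudoRiemannian I₁ g₁ q₁) (hg₂ : IsPseudoRiemannian I₂ g₂ q₂)
    (hP₁ : IsBivector P₁) (hP₂ : IsBivector P₂)
    (hf : ContMDiff I₁ 𝓘(ℝ, ℝ) ∞ f) (hf₀ : ∀ x, f x ≠ 0) (hν : ContMDiff I₁ 𝓘(ℝ, ℝ) ∞ ν)
    (hD₂ : IsLeviCivita P₂ g₂ D₂)
    (hD : IsLeviCivita (warpedBivector P₁ P₂ ν) (warpedMetric g₁ g₂ f) D)
    (hU₁ : IsOpen U₁) (hU₂ : IsOpen U₂) (hdx : IsOrthonormalCoframe g₁ q₁ U₁ dx)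
    (hdy : IsOrthonormalCoframe g₂ q₂ U₂ dy) (hp : p ∈ U₁ ×ˢ U₂) (i : Fin k₂) :
    D (fun q => f q.1 • vLift I₁ M₁ (dy i) q) (fun q => f q.1 • vLift I₁ M₁ (dy i) q) p =
      ((-((if (i : ℕ) < q₂ then -1 else 1) / f p.1)) •
        endo g₁ P₁ (differential I₁ f) p.1).comp (dπ₁ I₁ I₂ p) +
      ((ν p.1 * f p.1 ^ 2) • D₂ (dy i) (dy i) p.2).comp (dπ₂ I₁ I₂ p) := by
  obtain ⟨V, hVU, hV, hpV, W, hW, hWp⟩ := exists_smoothField_eq hU₂ hp.2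
    (musicalSharp g₂ p.2 (dy i p.2))
  have m₁ := fun x => hg₁.isMetricAt x
  have m₂ := fun y => hg₂.isMetricAt y
  have hdyV := fun j => (hdy.smooth j).mono hVU
  have hfd := hf.mdifferentiable (by simp) p.1
  have hνd := hν.mdifferentiable (by simp) p.1
  have hpp : p ∈ U₁ ×ˢ V := ⟨hp.1, hpV⟩
  have hsm : ∀ j, SmoothForm (I₁.prod I₂) (U₁ ×ˢ V) (fun q => f q.1 • vLift I₁ M₁ (dy j) q) :=
    fun j => ((hdyV j).vLift hV U₁).smul (hf.comp contMDiff_fst).contMDiffOn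
  have hW' : SmoothField I₂ V (fun y => (f p.1)⁻¹ • W y) := hW.smul contMDiffOn_const
  have hYhp : vField I₁ M₁ (fun y => (f p.1)⁻¹ • W y) p =
      musicalSharp (warpedMetric g₁ g₂ f) p (f p.1 • vLift I₁ M₁ (dy i) p) := by
    rw [musicalSharp_warpedMetric_vLift (m₁ _) (m₂ _) (hf₀ _), vField, hWp]
  have hcc : ∀ j, ∀ q ∈ U₁ ×ˢ V, cometric (warpedMetric g₁ g₂ f) q
      (f q.1 • vLift I₁ M₁ (dy i) q) (f q.1 • vLift I₁ M₁ (dy j) q) =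
      if i = j then (if (i : ℕ) < q₂ then -1 else 1) else 0 := by
    intro j q hq
    rw [cometric_warpedMetric_vLift_vLift (m₁ _) (m₂ _) (hf₀ _),
      hdy.orthonormal _ (hVU hq.2)]
  have key : ∀ γ : OneForm (I₁.prod I₂) (M₁ × M₂), SmoothForm (I₁.prod I₂) (U₁ ×ˢ V) γ → ∀ c : ℝ,
      (∀ q ∈ U₁ ×ˢ V, cometric (warpedMetric g₁ g₂ f) q
        (f q.1 • vLift I₁ M₁ (dy i) q) (γ q) = c) →
      D (fun q => f q.1 • vLift I₁ M₁ (dy i) q) (fun q => f q.1 • vLift I₁ M₁ (dy i) q) p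
        (musicalSharp (warpedMetric g₁ g₂ f) p (γ p)) =
      formBracket (warpedBivector P₁ P₂ ν) γ (fun q => f q.1 • vLift I₁ M₁ (dy i) q)
        (vField I₁ M₁ (fun y => (f p.1)⁻¹ • W y)) p :=
    fun γ hγ c hc => hD.apply_musicalSharp (hU₁.prod hV) (hsm i) hγ (hcc i) hc
      (hW'.vField U₁) hpp ((m₁ _).warpedMetric (m₂ _) (hf₀ _)) hYhp
  refine covector_ext ?_ ?_
  · refine hdx.apply_musicalSharp_ext hk₁ hp.1 (m₁ _) fun j => ?_
    have h := key _ ((hdx.smooth j).hLift hU₁ V) 0 fun q _ => by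
      rw [((m₁ _).warpedMetric (m₂ _) (hf₀ _)).cometric_comm]
      exact cometric_warpedMetric_hLift_vLift (m₁ _) (m₂ _) (hf₀ _) _ _
    rw [musicalSharp_warpedMetric_hLift (m₁ _) (m₂ _) (hf₀ _),
      formBracket_hLift_smul_vLift hP₁ hP₂ hνd hfd hU₁ hV (hdyV i) (hdx.smooth j) hW' hpp,
      map_smul, hWp, ← (m₂ _).cometric_eq, hdy.orthonormal _ hp.2, if_pos rfl] at h
    simp only [ContinuousLinearMap.comp_apply, add_apply, smul_apply, dπ₁_hLiftVec, dπ₂_hLiftVec,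
      map_zero, add_zero, smul_eq_mul, endo_apply_musicalSharp (m₁ _)]
    refine h.trans ?_
    rw [sharp, hP₁.skew p.1 (dx j p.1) (differential I₁ f p.1), smul_eq_mul]
    ring
  · refine hdy.apply_musicalSharp_ext hk₂ hp.2 (m₂ _) fun j => ?_
    have h := key _ (hsm j) _ (hcc j)
    have hbr := formBracket_smul_vLift_smul_vLift P₁ hP₂ hνd hfd hV (hdyV j) (hdyV i) hW' hpV
    have h' := hD₂.apply_musicalSharp hV (θ := dy i) (γ := dy j) (hdyV i) (hdyV j)
      (fun x hx => hdy.orthonormal x (hVU hx) i i) (fun x hx => hdy.orthonormal x (hVU hx) i j)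
      hW hpV (m₂ _) hWp
    have t₁ := hD₂.torsion_free V hV _ _ (hdyV j) (hdyV i) W hW p.2 hpV
    have t₂ := hD₂.torsion_free V hV _ _ (hdyV j) (hdyV i) _ hW' p.2 hpV
    rw [map_smul, map_smul, ← smul_sub, t₁, ← h'] at t₂
    rw [hbr, ← t₂, musicalSharp_warpedMetric_vLift (m₁ _) (m₂ _) (hf₀ _), map_smul, map_smul,
      smul_eq_mul, smul_eq_mul, mul_left_comm] at h
    simp only [ContinuousLinearMap.comp_apply, add_apply, smul_apply, dπ₁_vLiftVec, dπ₂_vLiftVec,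
      map_zero, zero_add, smul_eq_mul]
    refine (mul_left_cancel₀ (inv_ne_zero (hf₀ p.1)) h).trans ?_
    ring

end Connection

/-! ### The Laplacian of a sum of lifted functions -/

section Laplacian

variable {P₁ : BivectorField I₁ M₁} {P₂ : BivectorField I₂ M₂} {f ν : M₁ → ℝ}
  {u₁ : M₁ → ℝ} {u₂ : M₂ → ℝ} {u : M₁ × M₂ → ℝ}

theorem differential_fst_add_snd (hu₁ : MDifferentiable I₁ 𝓘(ℝ, ℝ) u₁)
    (hu₂ : MDifferentiable I₂ 𝓘(ℝ, ℝ) u₂) (hu : ∀ p, u p = u₁ p.1 + u₂ p.2) (p : M₁ × M₂)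
    (z : TangentSpace (I₁.prod I₂) p) :
    differential (I₁.prod I₂) u p z =
      differential I₁ u₁ p.1 (dπ₁ I₁ I₂ p z) + differential I₂ u₂ p.2 (dπ₂ I₁ I₂ p z) := by
  have h := mvfderiv_add
    ((hu₁ p.1).comp p (mdifferentiableAt_fst (I := I₁) (I' := I₂)))
    ((hu₂ p.2).comp p (mdifferentiableAt_snd (I := I₁) (I' := I₂)))
  rw [← differential_fst (hu₁ p.1), ← differential_snd (hu₂ p.2)]
  rw [show u = u₁ ∘ Prod.fst + u₂ ∘ Prod.snd from funext hu]
  exact DFunLike.congr_fun h z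

theorem derivFun_hLift (hu₁ : MDifferentiable I₁ 𝓘(ℝ, ℝ) u₁)
    (hu₂ : MDifferentiable I₂ 𝓘(ℝ, ℝ) u₂) (hu : ∀ p, u p = u₁ p.1 + u₂ p.2) (θ : OneForm I₁ M₁) :
    derivFun (warpedBivector P₁ P₂ ν) (hLift I₂ M₂ θ) u = fun p => derivFun P₁ θ u₁ p.1 := by
  funext p
  rw [derivFun, sharp_warpedBivector_hLift, differential_fst_add_snd hu₁ hu₂ hu, hField,
    dπ₁_hLiftVec, dπ₂_hLiftVec, map_zero, add_zero, derivFun]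

theorem derivFun_smul_vLift (hu₁ : MDifferentiable I₁ 𝓘(ℝ, ℝ) u₁)
    (hu₂ : MDifferentiable I₂ 𝓘(ℝ, ℝ) u₂) (hu : ∀ p, u p = u₁ p.1 + u₂ p.2) (η : OneForm I₂ M₂) :
    derivFun (warpedBivector P₁ P₂ ν) (fun p => f p.1 • vLift I₁ M₁ η p) u =
      fun p => (ν p.1 * f p.1) * derivFun P₂ η u₂ p.2 := by
  funext p
  rw [derivFun, sharp_warpedBivector_smul_vLift, map_smul, differential_fst_add_snd hu₁ hu₂ hu,
    vField, dπ₁_vLiftVec, dπ₂_vLiftVec, map_zero, zero_add, smul_eq_mul]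
  rfl

variable {D₁ : OneForm I₁ M₁ → OneForm I₁ M₁ → OneForm I₁ M₁}
  {D₂ : OneForm I₂ M₂ → OneForm I₂ M₂ → OneForm I₂ M₂}
  {D : OneForm (I₁.prod I₂) (M₁ × M₂) → OneForm (I₁.prod I₂) (M₁ × M₂) →
    OneForm (I₁.prod I₂) (M₁ × M₂)}
  {U₁ : Set M₁} {U₂ : Set M₂} {p : M₁ × M₂}

theorem secondDeriv_hLift [IsManifold I₁ ∞ M₁] (hP₁ : IsBivector P₁)
    (hu₁ : ContMDiff I₁ 𝓘(ℝ, ℝ) ∞ u₁)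
    (hu₂ : ContMDiff I₂ 𝓘(ℝ, ℝ) ∞ u₂) (hu : ∀ p, u p = u₁ p.1 + u₂ p.2) (hU₁ : IsOpen U₁)
    {θ : OneForm I₁ M₁} (hθ : SmoothForm I₁ U₁ θ) (hp : p.1 ∈ U₁)
    (hD : D (hLift I₂ M₂ θ) (hLift I₂ M₂ θ) p = (D₁ θ θ p.1).comp (dπ₁ I₁ I₂ p)) :
    secondDeriv (warpedBivector P₁ P₂ ν) D (hLift I₂ M₂ θ) (hLift I₂ M₂ θ) u p =
      secondDeriv P₁ D₁ θ θ u₁ p.1 := by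
  have hu₁d := hu₁.mdifferentiable (by simp)
  have hu₂d := hu₂.mdifferentiable (by simp)
  have hd : MDifferentiableAt I₁ 𝓘(ℝ, ℝ) (derivFun P₁ θ u₁) p.1 :=
    (((hP₁.smooth U₁ hU₁ θ hθ).contMDiffOn_differential_apply hu₁).contMDiffAt
      (hU₁.mem_nhds hp)).mdifferentiableAt (by simp)
  have h := warpedBivector_comp P₁ P₂ ν p (D₁ θ θ p.1) 0
  rw [ContinuousLinearMap.zero_comp, add_zero, map_zero, map_zero, smul_zero, add_zero] at h
  rw [secondDeriv, derivFun_hLift hu₁d hu₂d hu, derivFun, sharp_warpedBivector_hLift,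
    differential_fst hd, hField, dπ₁_hLiftVec, derivFun.eq_def _ (D _ _),
    sharp.eq_def _ (D _ _), hD, h, differential_fst_add_snd hu₁d hu₂d hu,
    dπ₁_hLiftVec, dπ₂_hLiftVec, map_zero, add_zero]
  rfl

theorem secondDeriv_smul_vLift [IsManifold I₂ ∞ M₂] (hP₂ : IsBivector P₂)
    (hf : ContMDiff I₁ 𝓘(ℝ, ℝ) ∞ f)
    (hν : ContMDiff I₁ 𝓘(ℝ, ℝ) ∞ ν) (hu₁ : ContMDiff I₁ 𝓘(ℝ, ℝ) ∞ u₁)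
    (hu₂ : ContMDiff I₂ 𝓘(ℝ, ℝ) ∞ u₂) (hu : ∀ p, u p = u₁ p.1 + u₂ p.2) (hU₂ : IsOpen U₂)
    {η : OneForm I₂ M₂} (hη : SmoothForm I₂ U₂ η) (hp : p.2 ∈ U₂)
    {α : TangentSpace I₁ p.1 →L[ℝ] ℝ}
    (hD : D (fun q => f q.1 • vLift I₁ M₁ η q) (fun q => f q.1 • vLift I₁ M₁ η q) p =
      α.comp (dπ₁ I₁ I₂ p) + ((ν p.1 * f p.1 ^ 2) • D₂ η η p.2).comp (dπ₂ I₁ I₂ p)) :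
    secondDeriv (warpedBivector P₁ P₂ ν) D (fun q => f q.1 • vLift I₁ M₁ η q)
        (fun q => f q.1 • vLift I₁ M₁ η q) u p =
      (ν p.1 * f p.1) ^ 2 * secondDeriv P₂ D₂ η η u₂ p.2
        - differential I₁ u₁ p.1 (P₁ p.1 α) := by
  have hu₁d := hu₁.mdifferentiable (by simp)
  have hu₂d := hu₂.mdifferentiable (by simp)
  have hd : MDifferentiableAt I₂ 𝓘(ℝ, ℝ) (derivFun P₂ η u₂) p.2 :=
    (((hP₂.smooth U₂ hU₂ η hη).contMDiffOn_differential_apply hu₂).contMDiffAt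
      (hU₂.mem_nhds hp)).mdifferentiableAt (by simp)
  have hνf : MDifferentiableAt I₁ 𝓘(ℝ, ℝ) (fun x => ν x * f x) p.1 :=
    (hν.mdifferentiable (by simp) p.1).mul (hf.mdifferentiable (by simp) p.1)
  rw [secondDeriv, derivFun_smul_vLift hu₁d hu₂d hu, derivFun, sharp_warpedBivector_smul_vLift,
    differential_fst_mul_snd (a := fun x => ν x * f x) hνf hd, derivFun.eq_def _ (D _ _), sharp,
    hD, warpedBivector_comp, differential_fst_add_snd hu₁d hu₂d hu]
  simp only [map_add, map_smul, vField, dπ₁_hLiftVec, dπ₂_hLiftVec, dπ₁_vLiftVec, dπ₂_vLiftVec,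
    smul_zero, add_zero, zero_add, map_zero, mul_zero, smul_eq_mul, secondDeriv,
    derivFun.eq_def P₂, sharp]
  ring

theorem differential_apply_endo [IsManifold I₁ ∞ M₁] [FiniteDimensional ℝ E₁]
    {g₁ : BilinField I₁ M₁} {x : M₁}
    (hg : IsMetricAt g₁ x) (hP₁ : IsBivector P₁) (u v : M₁ → ℝ) :
    differential I₁ v x (P₁ x (endo g₁ P₁ (differential I₁ u) x)) =
      -cometric g₁ x (endo g₁ P₁ (differential I₁ u) x) (endo g₁ P₁ (differential I₁ v) x) := by
  rw [hP₁.skew, hg.cometric_eq', endo.eq_def g₁ P₁ (differential I₁ v), hg.musicalSharp_flat]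

end Laplacian

end Product

end ContravariantWarped

end

open ContravariantWarped
theorem theorem3p6
    {k₁ k₂ : ℕ}
    {M₁ : Type*} [TopologicalSpace M₁] [ChartedSpace (EuclideanSpace ℝ (Fin k₁)) M₁]
    [IsManifold (𝓡 k₁) ∞ M₁]
    {M₂ : Type*} [TopologicalSpace M₂] [ChartedSpace (EuclideanSpace ℝ (Fin k₂)) M₂]
    [IsManifold (𝓡 k₂) ∞ M₂]
    -- the pseudo-Riemannian Poisson data on the factors
    (q₁ q₂ : ℕ)
    (g₁ : BilinField (𝓡 k₁) M₁)
    (g₂ : BilinField (𝓡 k₂) M₂)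
    (hg₁ : IsPseudoRiemannian (𝓡 k₁) g₁ q₁)
    (hg₂ : IsPseudoRiemannian (𝓡 k₂) g₂ q₂)
    (P₁ : BivectorField (𝓡 k₁) M₁)
    (P₂ : BivectorField (𝓡 k₂) M₂)
    (hP₁ : IsPoisson P₁)
    (hP₂ : IsPoisson P₂)
    -- the warping functions
    (f₁ ν₁ : M₁ → ℝ)
    (hf₁ : ContMDiff (𝓡 k₁) 𝓘(ℝ, ℝ) ∞ f₁) (hf₁_pos : ∀ x, 0 < f₁ x)
    (hν₁ : ContMDiff (𝓡 k₁) 𝓘(ℝ, ℝ) ∞ ν₁)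
    -- the contravariant Levi-Civita connections of the factors and of the warped product
    (D₁ : OneForm (𝓡 k₁) M₁ → OneForm (𝓡 k₁) M₁ →
      OneForm (𝓡 k₁) M₁)
    (hD₁ : IsLeviCivita P₁ g₁ D₁)
    (D₂ : OneForm (𝓡 k₂) M₂ → OneForm (𝓡 k₂) M₂ →
      OneForm (𝓡 k₂) M₂)
    (hD₂ : IsLeviCivita P₂ g₂ D₂)
    (D : OneForm ((𝓡 k₁).prod (𝓡 k₂)) (M₁ × M₂) →
      OneForm ((𝓡 k₁).prod (𝓡 k₂)) (M₁ × M₂) →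
      OneForm ((𝓡 k₁).prod (𝓡 k₂)) (M₁ × M₂))
    (hD : IsLeviCivita
      (warpedBivector P₁ P₂ ν₁)
      (warpedMetric g₁ g₂ f₁) D)
    -- local orthonormal coframes of the factors
    (U₁ : Set M₁) (hU₁ : IsOpen U₁) (U₂ : Set M₂) (hU₂ : IsOpen U₂)
    (dx : Fin k₁ → OneForm (𝓡 k₁) M₁)
    (hdx : IsOrthonormalCoframe g₁ q₁ U₁ dx)
    (dy : Fin k₂ → OneForm (𝓡 k₂) M₂)
    (hdy : IsOrthonormalCoframe g₂ q₂ U₂ dy)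
    -- the function `u = u₁^h + u₂^v`
    (u₁ : M₁ → ℝ) (hu₁ : ContMDiff (𝓡 k₁) 𝓘(ℝ, ℝ) ∞ u₁)
    (u₂ : M₂ → ℝ) (hu₂ : ContMDiff (𝓡 k₂) 𝓘(ℝ, ℝ) ∞ u₂)
    (u : M₁ × M₂ → ℝ) (hu : ∀ p, u p = u₁ p.1 + u₂ p.2) :
    ∀ p ∈ U₁ ×ˢ U₂,
      laplacian (warpedBivector P₁ P₂ ν₁) D
          (warpedCoframe f₁ dx dy) u p =
        laplacian P₁ D₁ dx u₁ p.1
        + ((k₂ : ℝ) - 2 * (q₂ : ℝ)) / f₁ p.1 *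
            cometric g₁ p.1
              (endo g₁ P₁ (differential (𝓡 k₁) f₁) p.1)
              (endo g₁ P₁ (differential (𝓡 k₁) u₁) p.1)
        + (ν₁ p.1 * f₁ p.1) ^ 2 * laplacian P₂ D₂ dy u₂ p.2 := by
  have hk₁ : k₁ = Module.finrank ℝ (EuclideanSpace ℝ (Fin k₁)) := by simp
  have hk₂ : k₂ = Module.finrank ℝ (EuclideanSpace ℝ (Fin k₂)) := by simp
  have hf₀ : ∀ x, f₁ x ≠ 0 := fun x => (hf₁_pos x).ne'
  intro p hp
  have hq₂ : q₂ ≤ k₂ := (hg₂.index_le p.2).trans_eq hk₂.symm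
  have h₁ : ∀ i, secondDeriv (warpedBivector P₁ P₂ ν₁) D (warpedCoframe f₁ dx dy (Sum.inl i))
      (warpedCoframe f₁ dx dy (Sum.inl i)) u p = secondDeriv P₁ D₁ (dx i) (dx i) u₁ p.1 :=
    fun i => secondDeriv_hLift hP₁.toIsBivector hu₁ hu₂ hu hU₁ (hdx.smooth i) hp.1
      (connection_hLift_hLift hk₁ hk₂ hg₁ hg₂ hP₁.toIsBivector hP₂.toIsBivector hf₁ hf₀ hν₁ hD₁ hD
        hU₁ hU₂ hdx hdy hp i)
  have h₂ : ∀ j, secondDeriv (warpedBivector P₁ P₂ ν₁) D (warpedCoframe f₁ dx dy (Sum.inr j))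
      (warpedCoframe f₁ dx dy (Sum.inr j)) u p =
      (ν₁ p.1 * f₁ p.1) ^ 2 * secondDeriv P₂ D₂ (dy j) (dy j) u₂ p.2
        - (if (j : ℕ) < q₂ then -1 else 1) * (cometric g₁ p.1
          (endo g₁ P₁ (differential (𝓡 k₁) f₁) p.1)
          (endo g₁ P₁ (differential (𝓡 k₁) u₁) p.1) / f₁ p.1) := by
    intro j
    refine (secondDeriv_smul_vLift hP₂.toIsBivector hf₁ hν₁ hu₁ hu₂ hu hU₂ (hdy.smooth j) hp.2
      (connection_vLift_vLift hk₁ hk₂ hg₁ hg₂ hP₁.toIsBivector hP₂.toIsBivector hf₁ hf₀ hν₁ hD₂ hD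
        hU₁ hU₂ hdx hdy hp j)).trans ?_
    rw [map_smul, map_smul, differential_apply_endo (hg₁.isMetricAt _) hP₁.toIsBivector,
      smul_eq_mul]
    ring
  rw [laplacian, Fintype.sum_sum_type, Finset.sum_congr rfl fun i _ => h₁ i,
    Finset.sum_congr rfl fun j _ => h₂ j, Finset.sum_sub_distrib, ← Finset.mul_sum,
    ← Finset.sum_mul, sum_signs hq₂, laplacian, laplacian]
  ring
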